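/- Let $\Phi=\{\pm\alpha,\pm\beta,\pm(\alpha+\beta)\}$ be the root system of type $A_2$ in the Euclidean plane $V$, with simple roots $\alpha,\beta$ and $\Phi^+=\{\alpha,\beta,\alpha+\beta\}$. Let $V'=V\oplus\mathbb R\delta$, with the inner product extended by $(\delta,V')=0$. For $\Lambda\subseteq\Phi$ let $\Lambda^\wedge$ be the set of all $\gamma+n\delta$ with $\gamma\in\Lambda\cap\Phi^+$, $n\ge 0$, or $\gamma\in\Lambda\cap\Phi^-$, $n\ge 1$. The affine roots are $\widetilde\Phi=\Phi^\wedge\sqcup-\Phi^\wedge$, the positive ones being $\Phi^\wedge$. Let $\widetilde W$ be the affine Weyl group of type $\widetilde A_2$, generated by the reflections $s_\gamma(x)=x-2\frac{(x,\gamma)}{(\gamma,\gamma)}\gamma$, $\gamma\in\widetilde\Phi$; its simple reflections are $s_\alpha,s_\beta,s_{\delta-\alpha-\beta}$, and $l$ is the usual length. Let $T\le\widetilde W$ be the translation subgroup, generated by $t_{\alpha^\vee},t_{\beta^\vee}$, where $t_v(x)=x+(x,v)\delta$ and $\gamma^\vee=2\gamma/(\gamma,\gamma)$. Put $N(w)=\{\gamma\in\Phi^\wedge: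 w^{-1}\gamma\in-\Phi^\wedge\}$, $B=\{\alpha,\alpha+\beta,\beta\}^\wedge$ and $l_B(w)=l(w)-2|N(w^{-1})\cap B|$. Write $x\le_B y$ if $y=t_k\cdots t_1x$ for some $k\ge 0$ and reflections $t_1,\dots,t_k$ with $l_B(t_i\cdots t_1x)=l_B(t_{i-1}\cdots t_1x)+1$ for $1\le i\le k$. If $x\le_B y$, the interval $[x,y]=\{z: x\le_B z\le_B y\}$ has length $l_B(y)-l_B(x)$; it is called spherical if every length 2 interval contained in it has exactly 4 elements. **(1)** (a) Every length 2 interval of $(\widetilde W,\le_B)$ is either of the form $[x,s_1s_2x]$ with $s_1\ne s_2$ in $\{s_\alpha,s_\beta,s_{\delta-\alpha-\beta}\}$, or of the form $[x,s_{\delta-\gamma}s_\gamma x]$ with $\gamma\in\{\alpha,\beta,\alpha+\beta,\delta-\alpha,\delta-\beta,\delta-\alpha-\beta\}$. Length 2 intervals of the former kind are spherical, those of the latter kind are not. (b) The following are intervals of length 3, and they are exactly the spherical intervals of length 3: $[x,s_\alpha s_\beta s_\alpha x]$ for $x\in s_\alpha s_\beta s_\alpha T$; $[x,s_{\delta-\alpha-\beta}s_\beta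 s_{\delta-\alpha-\beta}x]$ for $x\in s_\beta T$; $[x,s_\alpha s_{\delta-\alpha-\beta}s_\alpha x]$ for $x\in s_\alpha T$. (c) No interval of length greater than 3 is spherical. **(2)** The periodic infinite words $(s_\beta s_{\delta-\alpha-\beta}s_\alpha)^\infty$ and $(s_\alpha s_{\delta-\alpha-\beta}s_\beta)^\infty$ are reduced. For an infinite reduced word $r_1r_2\cdots$, an element $g\in\widetilde W$ is a prefix of it if $N(g)\subseteq\bigcup_n N(r_1\cdots r_n)$. For every $i\ge 0$ each of these two words has a unique prefix of length $i$, namely the product of its first $i$ letters; call it $w(i)$ for the first word and $w(-i)$ for the second. Let $v=s_{\delta-\alpha-\beta}$, $u=s_\alpha s_\beta s_\alpha$ and let $U$ be the subgroup of $\widetilde W$ generated by $v$ and $u$. Then $U$ is infinite dihedral. For $x\in\widetilde W$ and $y\in xU$, $y$ is the unique element of minimal length in the left coset $xU$ if and only if $y=w(i)^{-1}$ for some $i\in\mathbb Z$. Every element of $\widetilde W$ can be written as $w(i)^{-1}z$ with $i\in\mathbb Z$ and $z\in U$. Moreover, for all $i,k\in\mathbb Z$: (a) $l_B(w(i)^{-1}u(vu)^k)$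 is $-4k-3$ if $i$ is even and $-4k-2$ if $i$ is odd; (b) $l_B(w(i)^{-1}(vu)^k)$ is $-4k$ if $i$ is even and $-4k-1$ if $i$ is odd; (c) $l_B(w(i)^{-1}v(uv)^k)$ is $4k+1$ if $i$ is even and $4k+2$ if $i$ is odd; (d) $l_B(w(i)^{-1}(uv)^k)$ is $4k$ if $i$ is even and $4k-1$ if $i$ is odd. **(3)** If $x,y\in\widetilde W$ and $l_B(x)\equiv l_B(y)\pmod 2$, then there is a poset automorphism $\gamma$ of $(\widetilde W,\le_B)$ with $\gamma(x)=y$. -/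

import Mathlib

open scoped Pointwise

noncomputable section

namespace AffineA2

/-! The finite root system of type A₂ -/

/-- The Euclidean plane `V` spanned by the root system of type `A₂`, in the coordinates given by
the simple roots: `(a, b)` is the vector `a α + b β`. -/
abbrev V := ℝ × ℝ

/-- The space `V' = V ⊕ ℝ δ`: the pair `(v, c)` is the vector `v + c δ`. -/
abbrev V' := V × ℝ

/-- The simple root `α` as a vector of `V'`. -/
def α : V' := ((1, 0), 0)

/-- The simple root `β` as a vector of `V'`. -/
def β : V' := ((0, 1), 0)

/-- The vector `δ` of `V'`. -/
def δ : V' := ((0, 0), 1)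

/-- The symmetric bilinear form on `V'` with `(α, α) = (β, β) = 2`, `(α, β) = -1` and
`(δ, v) = 0` for every `v`. -/
def form (u v : V') : ℝ :=
  2 * u.1.1 * v.1.1 - u.1.1 * v.1.2 - u.1.2 * v.1.1 + 2 * u.1.2 * v.1.2

/-- The standard positive system `Φ⁺ = {α, β, α + β}` of the finite root system, inside `V`. -/
def finPos : Set V := {(1, 0), (0, 1), (1, 1)}

/-- The finite root system `Φ = Φ⁺ ∪ -Φ⁺`. -/
def finRoots : Set V := finPos ∪ -finPos

/-! The affine root system -/

/-- `Λ^∧ = ⋃_{γ ∈ Λ} {γ}^∧`, where `{γ}^∧ = {γ + n δ | n ≥ 0}` if `γ ∈ Φ⁺` and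
`{γ}^∧ = {γ + (n + 1) δ | n ≥ 0}` if `γ ∈ Φ⁻ = -Φ⁺`. -/
def hat (Λ : Set V) : Set V' :=
  {v | ∃ γ ∈ Λ, ∃ n : ℕ,
    (γ ∈ finPos ∧ v = (γ, (n : ℝ))) ∨ (γ ∈ -finPos ∧ v = (γ, (n : ℝ) + 1))}

/-- The positive affine roots `Φ^∧`. -/
def posRoots : Set V' := hat finRoots

/-- The negative affine roots `-Φ^∧`. -/
def negRoots : Set V' := -posRoots

/-- All affine roots. -/
def roots : Set V' := posRoots ∪ negRoots

theorem reflection_involutive (γ : V') :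
    Function.Involutive (fun v : V' => v - (2 * form v γ / form γ γ) • γ) := by
  intro v
  by_cases h : form γ γ = 0
  · simp [h]
  · have key : form (v - (2 * form v γ / form γ γ) • γ) γ = - form v γ := by
      have h1 : ∀ c : ℝ, form (v - c • γ) γ = form v γ - c * form γ γ := by
        intro c
        simp only [form, Prod.fst_sub, Prod.snd_sub, Prod.smul_fst, Prod.smul_snd, smul_eq_mul]
        ring
      rw [h1, div_mul_cancel₀ _ h]
      ring
    simp only [key]
    rw [sub_sub, ← add_smul]
    have : 2 * form v γ / form γ γ + 2 * -form v γ / form γ γ = 0 := by ring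
    rw [this, zero_smul, sub_zero]

/-- The reflection `s_γ : v ↦ v - 2 (v, γ) / (γ, γ) γ` of `V'`. -/
def s (γ : V') : V' ≃ₗ[ℝ] V' :=
  LinearEquiv.ofInvolutive
    { toFun := fun v => v - (2 * form v γ / form γ γ) • γ
      map_add' := by
        intro u v
        have : form (u + v) γ = form u γ + form v γ := by
          simp only [form, Prod.fst_add, Prod.snd_add]
          ring
        rw [this, mul_add, add_div, add_smul]
        abel
      map_smul' := by
        intro c v
        have : form (c • v) γ = c * form v γ := by
          simp only [form, Prod.smul_fst, Prod.smul_snd, smul_eq_mul]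
          ring
        rw [this, RingHom.id_apply, smul_sub, smul_smul]
        congr 2
        ring }
    (reflection_involutive γ)

/-- The affine Weyl group of type `Ã₂`: the group generated by the reflections `s_γ` in all the
affine roots `γ`. -/
def weylGroup : Subgroup (V' ≃ₗ[ℝ] V') := Subgroup.closure {g | ∃ γ ∈ roots, g = s γ}

/-- The affine Weyl group as a type. -/
abbrev W := ↥weylGroup

theorem s_mem {γ : V'} (h : γ ∈ roots) : s γ ∈ weylGroup :=
  Subgroup.subset_closure ⟨γ, h, rfl⟩

theorem α_mem : α ∈ roots := by
  refine Or.inl ⟨(1, 0), Or.inl ?_, 0, Or.inl ⟨?_, ?_⟩⟩ <;> simp [finPos, α]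

theorem β_mem : β ∈ roots := by
  refine Or.inl ⟨(0, 1), Or.inl ?_, 0, Or.inl ⟨?_, ?_⟩⟩ <;> simp [finPos, β]

theorem δ_sub_mem : δ - α - β ∈ roots := by
  refine Or.inl ⟨(-1, -1), Or.inr ?_, 0, Or.inr ⟨?_, ?_⟩⟩ <;> simp [finPos, α, β, δ]

/-- The simple reflection `s_α`. -/
def sα : W := ⟨s α, s_mem α_mem⟩

/-- The simple reflection `s_β`. -/
def sβ : W := ⟨s β, s_mem β_mem⟩

/-- The simple reflection `s_{δ-α-β}`. -/
def s₀ : W := ⟨s (δ - α - β), s_mem δ_sub_mem⟩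

/-- The set of simple reflections. -/
def S : Set W := {sα, sβ, s₀}

/-- The set of all reflections of the affine Weyl group. -/
def reflections : Set W := {t | ∃ γ ∈ roots, (t : V' ≃ₗ[ℝ] V') = s γ}

/-- The usual length of an element: the least length of a word in the simple reflections that
represents it. -/
def length (w : W) : ℕ :=
  sInf {n | ∃ L : List W, (∀ r ∈ L, r ∈ S) ∧ L.prod = w ∧ L.length = n}

/-- The inversion set `N(w) = {γ positive | w⁻¹ γ negative}`. -/
def N (w : W) : Set V' := {γ | γ ∈ posRoots ∧ ((w⁻¹ : W) : V' ≃ₗ[ℝ] V') γ ∈ negRoots}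

/-! Translations -/

/-- The map `t_v : u ↦ u + (u, v) δ` for `v ∈ V`. -/
def translation (v : V) : V' ≃ₗ[ℝ] V' where
  toFun u := u + form u (v, 0) • δ
  invFun u := u - form u (v, 0) • δ
  map_add' x y := by
    have : form (x + y) (v, 0) = form x (v, 0) + form y (v, 0) := by
      simp only [form, Prod.fst_add, Prod.snd_add]
      ring
    rw [this, add_smul]
    abel
  map_smul' c x := by
    have : form (c • x) (v, 0) = c * form x (v, 0) := by
      simp only [form, Prod.smul_fst, Prod.smul_snd, smul_eq_mul]
      ring
    rw [this, RingHom.id_apply, smul_add, smul_smul]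
  left_inv x := by
    ext <;> simp [form, δ]
  right_inv x := by
    ext <;> simp [form, δ]

/-- The coroot `γ^∨ = 2 γ / (γ, γ)` of a root `γ ∈ Φ`. -/
def coroot (γ : V) : V := (2 / form (γ, 0) (γ, 0)) • γ

/-- The translation subgroup `T`, generated by the translations by the simple coroots. -/
def T : Subgroup W :=
  (Subgroup.closure {translation (coroot (1, 0)), translation (coroot (0, 1))}).subgroupOf weylGroup

/-! Twisted Bruhat orders -/

/-- The (left) `B`-twisted length `l_B(w) = l(w) - 2 |N(w⁻¹) ∩ B|`. -/
def twistedLength (B : Set V') (w : W) : ℤ := (length w : ℤ) - 2 * ((N w⁻¹ ∩ B).ncard : ℤ)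

/-- The (left) `B`-twisted strong Bruhat order: `x ≤_B y` if there are reflections
`t₁, …, t_k` with `y = t_k ⋯ t₁ x` such that each successive multiplication raises the
`B`-twisted length by exactly one. -/
def twistedLE (B : Set V') : W → W → Prop :=
  Relation.ReflTransGen
    (fun x y => ∃ t ∈ reflections, y = t * x ∧ twistedLength B y = twistedLength B x + 1)

/-- The biclosed set `B = {α, α + β, β}^∧`. -/
def B : Set V' := hat finPos

/-- The twisted length `l_B` for the alcove order. -/
def lB (w : W) : ℤ := twistedLength B w

/-- The alcove order `≤_B`. -/
def leB : W → W → Prop := twistedLE B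

/-- The closed interval `[x, y]` in the alcove order. -/
def interval (x y : W) : Set W := {z | leB x z ∧ leB z y}

/-- `[x, y]` is an interval (i.e. `x ≤_B y`) of length `n`; the order is graded by `l_B`. -/
def IsIntervalOfLength (x y : W) (n : ℕ) : Prop := leB x y ∧ lB y = lB x + n

/-- The interval `[x, y]` is spherical: each of its subintervals of length 2 has 4 elements. -/
def IsSpherical (x y : W) : Prop :=
  ∀ a b : W, leB x a → leB b y → IsIntervalOfLength a b 2 → (interval a b).ncard = 4

/-! Infinite reduced words -/

/-- The product `r₁ r₂ ⋯ r_n` of the first `n` letters of an infinite word. -/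
def partialProd (r : ℕ → W) (n : ℕ) : W := ((List.range n).map r).prod

/-- An infinite reduced word in the simple reflections. -/
def IsInfiniteReducedWord (r : ℕ → W) : Prop :=
  (∀ n, r n ∈ S) ∧ ∀ n, length (partialProd r n) = n

/-- The inversion set of an infinite word: the union of those of its partial products. -/
def infN (r : ℕ → W) : Set V' := ⋃ n, N (partialProd r n)

/-- `g` is a (finite) prefix of the infinite reduced word `r`. -/
def IsPrefix (g : W) (r : ℕ → W) : Prop := N g ⊆ infN r

/-- The periodic infinite word `a b c a b c a b c ⋯`. -/
def periodicWord (a b c : W) (n : ℕ) : W :=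
  if n % 3 = 0 then a else if n % 3 = 1 then b else c

/-- The infinite word `(s_β s_{δ-α-β} s_α)^∞`. -/
def xWord : ℕ → W := periodicWord sβ s₀ sα

/-- The infinite word `(s_α s_{δ-α-β} s_β)^∞`. -/
def yWord : ℕ → W := periodicWord sα s₀ sβ

/-- For `i ≥ 0`, `w(i)` is the product of the first `i` letters of `xWord`, and `w(-i)` is the
product of the first `i` letters of `yWord`. -/
def pre : ℤ → W
  | Int.ofNat n => partialProd xWord n
  | Int.negSucc n => partialProd yWord (n + 1)

/-! The infinite dihedral subgroup -/

/-- `v = s_{δ-α-β}`. -/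
def v : W := s₀

/-- `u = s_α s_β s_α`. -/
def u : W := sα * sβ * sα

/-- The subgroup `U` generated by `v` and `u`. -/
def U : Subgroup W := Subgroup.closure {v, u}

/-- `y` is the unique element of minimal length of the subset `C`. -/
def IsUniqueMinimal (C : Set W) (y : W) : Prop :=
  y ∈ C ∧ ∀ z ∈ C, z ≠ y → length y < length z

end AffineA2

end

open AffineA2

open AffineA2

/-!
An element `w` of the affine Weyl group is encoded by the signed numbers of hyperplanes of each of
the three directions that separate the alcove of `w⁻¹` from the fundamental one: for
`γ ∈ {α, β, α + β}` there is an integer `d_γ` with `w (γ + k δ)` negative exactly when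
`k + d_γ < 0`. Since `d_{α + β} - d_α - d_β` is `0` or `1` (the two orientations of the triangular
alcoves), `w` is determined by `a = d_α`, `b = d_β` and a Boolean `ε`, and every triple occurs:
`W` is in bijection with `ℤ × ℤ × Bool` (`coords`, with `alcove a b ε` the element with
coordinates `(a, b, ε)`).

In these coordinates everything is linear. The length is `|a| + |b| + |a + b + ε|`
(`length_alcove`), because left multiplication by a simple reflection changes exactly one of the
three numbers by one (`letter_mul_alcove`), and the twisted length is `2 (a + b) + ε` (`lB_alcove`).
The covering relations of the alcove order (`covers_false_iff`, `covers_true_iff`) are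
* `(a, b, 0) < (a + 1, b - 1, 1), (a, b, 1), (a - 1, b + 1, 1)`,
* `(a, b, 1) < (a + 1, b, 0), (a, b + 1, 0)`.

They are invariant under all translations of `(a, b)`, not only those by coroots, so the
automorphisms are transitive on the elements with the same `ε` (`exists_automorphism`). Above
`(a, b, ε)` there are four elements at distance 2: `(a + 1, b, ε)` and `(a, b + 1, ε)`, each reached by two chains, and
`(a + 2, b - 1, ε)` and `(a - 1, b + 2, ε)`, each reached by only one (`isSpherical_two_alcove`). It
follows that a spherical interval of length 3 has to go from `(a, b, 1)` to `(a + 1, b + 1, 0)`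
(`isSpherical_three_alcove`); in particular its bottom has odd twisted length. A longer spherical
interval would contain two such intervals with consecutive bottoms, which parity forbids
(`not_isSpherical_of_three_lt`). The cosets of `T` are told apart by `ε` and by `a - b` modulo 3,
which also decides which simple reflection crosses which wall.

The inverses `w(i)⁻¹` run through the elements with `a + b + ε = 0`, that is, through the
strip of alcoves between two neighbouring hyperplanes of direction `α + β` (`pre_inv`), and
`a - b = i`. Right multiplication by `u` and `v` reflects in the two sides of that strip, so
the cosets of `U` are the fibres of `a - b` (`alcove_mem_smul_U`), and `|a| + |b| + |a + b + ε|` is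
minimal on a fibre exactly at the element of the strip.
-/

noncomputable section

namespace AlcoveModel

/-! ### Normal form of the elements of the affine Weyl group -/

/-- The six elements of the finite Weyl group, named by their reduced words in `a = s_α` and
`b = s_β`. -/
inductive FinW
  | e | a | b | ab | ba | aba
  deriving DecidableEq

namespace FinW

/-- Left multiplication by `s_α`. -/
def lmulα : FinW → FinW
  | e => a | a => e | b => ab | ab => b | ba => aba | aba => ba

/-- Left multiplication by `s_β`. -/
def lmulβ : FinW → FinW
  | e => b | b => e | a => ba | ba => a | ab => aba | aba => ab

/-- Left multiplication by the reflection in the highest root `α + β`. -/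
def lmulθ : FinW → FinW
  | e => aba | aba => e | a => ab | ab => a | b => ba | ba => b

/-- Right multiplication by the reflection in the highest root `α + β`. -/
def rmulθ : FinW → FinW
  | e => aba | aba => e | a => ba | ba => a | b => ab | ab => b

/-- The inverse. -/
def inv : FinW → FinW
  | ab => ba | ba => ab | g => g

/-- The action on the lattice or the plane spanned by the simple roots, in the coordinates given
by `α` and `β`. -/
def act {R : Type*} [Ring R] : FinW → R × R → R × R
  | e, x => x
  | a, x => (x.2 - x.1, x.2)
  | b, x => (x.1, x.1 - x.2)
  | ab, x => (-x.2, x.1 - x.2)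
  | ba, x => (x.2 - x.1, -x.1)
  | aba, x => (-x.2, -x.1)

/-- `1` if the element sends `α` to a negative root, `0` otherwise. -/
def negα : FinW → ℤ
  | a => 1 | ab => 0 | ba => 1 | aba => 1 | _ => 0

/-- `1` if the element sends `β` to a negative root, `0` otherwise. -/
def negβ : FinW → ℤ
  | b => 1 | ab => 1 | ba => 0 | aba => 1 | _ => 0

/-- Whether the element has determinant `-1`. -/
def odd : FinW → Bool
  | a => true | b => true | aba => true | _ => false

end FinW

theorem s_α_apply (k x y z : ℝ) :
    s ((1, 0), k) ((x, y), z) = ((y - x, y), z - k * (2 * x - y)) := by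
  simp only [s, LinearEquiv.coe_ofInvolutive, LinearMap.coe_mk, AddHom.coe_mk, form]
  ext <;> simp <;> ring

theorem s_β_apply (k x y z : ℝ) :
    s ((0, 1), k) ((x, y), z) = ((x, x - y), z - k * (2 * y - x)) := by
  simp only [s, LinearEquiv.coe_ofInvolutive, LinearMap.coe_mk, AddHom.coe_mk, form]
  ext <;> simp <;> ring

theorem s_θ_apply (k x y z : ℝ) :
    s ((1, 1), k) ((x, y), z) = ((-y, -x), z - k * (x + y)) := by
  simp only [s, LinearEquiv.coe_ofInvolutive, LinearMap.coe_mk, AddHom.coe_mk, form]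
  ext <;> simp <;> ring

theorem s_neg (γ : V') : s (-γ) = s γ := by
  ext x <;>
  simp only [s, LinearEquiv.coe_ofInvolutive, LinearMap.coe_mk, AddHom.coe_mk, form,
    Prod.fst_neg, Prod.snd_neg, Prod.fst_sub, Prod.snd_sub, Prod.smul_fst, Prod.smul_snd,
    smul_eq_mul] <;> ring_nf

theorem s_mul_self (γ : V') : s γ * s γ = 1 := by
  ext1 x
  exact reflection_involutive γ x

theorem s_inv (γ : V') : (s γ)⁻¹ = s γ := inv_eq_of_mul_eq_one_left (s_mul_self γ)

theorem translation_apply (p q x y z : ℝ) :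
    translation (p, q) ((x, y), z) = ((x, y), z + ((2 * p - q) * x + (2 * q - p) * y)) := by
  change ((x, y), z) + form ((x, y), z) ((p, q), 0) • δ = _
  simp only [form, δ]
  ext <;> simp; ring

theorem translation_add (v w : V) :
    translation (v + w) = translation v * translation w := by
  obtain ⟨p, q⟩ := v
  obtain ⟨p', q'⟩ := w
  apply LinearEquiv.ext
  rintro ⟨⟨x, y⟩, z⟩
  rw [LinearEquiv.mul_apply, Prod.mk_add_mk]
  simp only [translation_apply]
  ext <;> simp; ring

/-- The translations by the vectors of the root lattice, as a homomorphism. -/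
def translationHom : Multiplicative (ℤ × ℤ) →* (V' ≃ₗ[ℝ] V') where
  toFun x := translation ((x.toAdd.1 : ℝ), (x.toAdd.2 : ℝ))
  map_one' := by
    apply LinearEquiv.ext
    rintro ⟨⟨x, y⟩, z⟩
    simp [translation_apply]
  map_mul' x y := by
    rw [← translation_add]
    simp

theorem closure_translation :
    Subgroup.closure {translation (coroot (1, 0)), translation (coroot (0, 1))} =
      translationHom.range := by
  have h1 : translation (coroot (1, 0)) = translationHom (.ofAdd (1, 0)) := by
    simp [translationHom, coroot, form]
  have h2 : translation (coroot (0, 1)) = translationHom (.ofAdd (0, 1)) := by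
    simp [translationHom, coroot, form]
  apply le_antisymm
  · rw [Subgroup.closure_le]
    rintro x (rfl | rfl)
    exacts [⟨_, h1.symm⟩, ⟨_, h2.symm⟩]
  · rintro _ ⟨x, rfl⟩
    have hx : x = (Multiplicative.ofAdd (1, 0)) ^ x.toAdd.1 *
        (Multiplicative.ofAdd ((0, 1) : ℤ × ℤ)) ^ x.toAdd.2 := by
      apply Multiplicative.toAdd.injective
      ext <;> simp
    rw [hx, map_mul, map_zpow, map_zpow, ← h1, ← h2]
    exact mul_mem (zpow_mem (Subgroup.subset_closure (by simp)) _)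
      (zpow_mem (Subgroup.subset_closure (by simp)) _)

theorem mem_roots_of_finPos {γ : V} (hγ : γ ∈ finPos) (k : ℤ) : ((γ, (k : ℝ)) : V') ∈ roots := by
  rcases le_or_gt 0 k with hk | hk
  · lift k to ℕ using hk
    exact Or.inl ⟨γ, Or.inl hγ, k, Or.inl ⟨hγ, by simp⟩⟩
  · obtain ⟨n, rfl⟩ : ∃ n : ℕ, k = -(n + 1) := ⟨(-k - 1).toNat, by omega⟩
    refine Or.inr ⟨-γ, Or.inr (by simpa using hγ), n, Or.inr ⟨by simpa using hγ, ?_⟩⟩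
    simp

/-- As `s_{-γ} = s_γ`, the reflections are the `s_{γ + k δ}` with `γ ∈ Φ⁺` and `k ∈ ℤ`. -/
theorem reflection_iff {t : V' ≃ₗ[ℝ] V'} :
    (∃ γ ∈ roots, t = s γ) ↔ ∃ γ ∈ finPos, ∃ k : ℤ, t = s (γ, (k : ℝ)) := by
  constructor
  · have key : ∀ γ ∈ posRoots, ∃ γ' ∈ finPos, ∃ k : ℤ, s γ = s (γ', (k : ℝ)) := by
      rintro _ ⟨γ, -, n, ⟨hγ, rfl⟩ | ⟨hγ, rfl⟩⟩
      · exact ⟨γ, hγ, n, by simp⟩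
      · refine ⟨-γ, hγ, -(n + 1), ?_⟩
        rw [← s_neg]
        simp
    rintro ⟨γ, hγ | hγ, rfl⟩
    · exact key γ hγ
    · obtain ⟨γ', h, k, e⟩ := key _ hγ
      exact ⟨γ', h, k, by rw [← e, s_neg]⟩
  · rintro ⟨γ, hγ, k, rfl⟩
    exact ⟨_, mem_roots_of_finPos hγ k, rfl⟩

theorem s₀_eq : s (δ - α - β) = s ((1, 1), ((-1 : ℤ) : ℝ)) := by
  rw [← s_neg]
  congr 1
  ext <;> simp [α, β, δ]

theorem translation_mem (m n : ℤ) : translation ((m : ℝ), (n : ℝ)) ∈ weylGroup := by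
  have key : Subgroup.closure {translation (coroot (1, 0)), translation (coroot (0, 1))} ≤
      weylGroup := by
    rw [Subgroup.closure_le]
    have h1 : translation (coroot (1, 0)) =
        s ((1, 0), ((1 : ℤ) : ℝ)) * s ((1, 0), ((0 : ℤ) : ℝ)) := by
      apply LinearEquiv.ext
      rintro ⟨⟨x, y⟩, z⟩
      rw [LinearEquiv.mul_apply]
      simp only [s_α_apply, coroot, form, translation_apply, Prod.smul_mk]
      ext <;> simp
      ring
    have h2 : translation (coroot (0, 1)) =
        s ((0, 1), ((1 : ℤ) : ℝ)) * s ((0, 1), ((0 : ℤ) : ℝ)) := by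
      apply LinearEquiv.ext
      rintro ⟨⟨x, y⟩, z⟩
      rw [LinearEquiv.mul_apply]
      simp only [s_β_apply, coroot, form, translation_apply, Prod.smul_mk]
      ext <;> simp
      ring
    rintro x (rfl | rfl)
    · rw [h1]
      exact mul_mem (s_mem (mem_roots_of_finPos (by simp [finPos]) _))
        (s_mem (mem_roots_of_finPos (by simp [finPos]) _))
    · rw [h2]
      exact mul_mem (s_mem (mem_roots_of_finPos (by simp [finPos]) _))
        (s_mem (mem_roots_of_finPos (by simp [finPos]) _))
  apply key
  rw [closure_translation]
  exact ⟨.ofAdd (m, n), by simp [translationHom]⟩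

/-- The element of the affine Weyl group given by an element of the finite one. -/
def FinW.toW : FinW → W
  | .e => 1 | .a => sα | .b => sβ | .ab => sα * sβ | .ba => sβ * sα | .aba => sα * sβ * sα

/-- The element `g t_λ` with `λ = m α + n β`. By `elt_surjective` and `elt_inj` this is a normal
form for the elements of the affine Weyl group, as the semidirect product of the finite Weyl group
and the translations. -/
def elt (g : FinW) (m n : ℤ) : W := g.toW * ⟨_, translation_mem m n⟩

theorem sα_coe : (sα : V' ≃ₗ[ℝ] V') = s ((1, 0), 0) := rfl

theorem sβ_coe : (sβ : V' ≃ₗ[ℝ] V') = s ((0, 1), 0) := rfl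

theorem s₀_coe : (s₀ : V' ≃ₗ[ℝ] V') = s ((1, 1), ((-1 : ℤ) : ℝ)) := s₀_eq

theorem u_coe : (u : V' ≃ₗ[ℝ] V') = s ((1, 1), ((0 : ℤ) : ℝ)) := by
  apply LinearEquiv.ext
  rintro ⟨⟨x, y⟩, z⟩
  simp [u, sα_coe, sβ_coe, LinearEquiv.mul_apply, s_α_apply, s_β_apply, s_θ_apply]
  ring

theorem elt_apply (g : FinW) (m n : ℤ) (x y z : ℝ) :
    (elt g m n : V' ≃ₗ[ℝ] V') ((x, y), z) =
      (g.act (x, y), z + ((2 * m - n) * x + (2 * n - m) * y)) := by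
  cases g <;>
  simp [elt, FinW.toW, FinW.act, translation_apply, sα_coe, sβ_coe, LinearEquiv.mul_apply,
    s_α_apply, s_β_apply]
  ring

theorem W_ext {x y : W} (h : ∀ a b c : ℝ, (x : V' ≃ₗ[ℝ] V') ((a, b), c) =
    (y : V' ≃ₗ[ℝ] V') ((a, b), c)) : x = y :=
  Subtype.ext (LinearEquiv.ext fun ⟨⟨a, b⟩, c⟩ => h a b c)

theorem s_α_mul_elt (g : FinW) (m n k : ℤ) :
    s ((1, 0), (k : ℝ)) * (elt g m n : V' ≃ₗ[ℝ] V') =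
      elt g.lmulα (m - k * (g.inv.act (1, 0)).1) (n - k * (g.inv.act (1, 0)).2) := by
  apply LinearEquiv.ext
  rintro ⟨⟨x, y⟩, z⟩
  cases g <;>
  · rw [LinearEquiv.mul_apply, elt_apply, elt_apply]
    ext <;> simp [s_α_apply, FinW.act, FinW.inv, FinW.lmulα]
    all_goals ring

theorem s_β_mul_elt (g : FinW) (m n k : ℤ) :
    s ((0, 1), (k : ℝ)) * (elt g m n : V' ≃ₗ[ℝ] V') =
      elt g.lmulβ (m - k * (g.inv.act (0, 1)).1) (n - k * (g.inv.act (0, 1)).2) := by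
  apply LinearEquiv.ext
  rintro ⟨⟨x, y⟩, z⟩
  cases g <;>
  · rw [LinearEquiv.mul_apply, elt_apply, elt_apply]
    ext <;> simp [s_β_apply, FinW.act, FinW.inv, FinW.lmulβ]
    all_goals ring

theorem s_θ_mul_elt (g : FinW) (m n k : ℤ) :
    s ((1, 1), (k : ℝ)) * (elt g m n : V' ≃ₗ[ℝ] V') =
      elt g.lmulθ (m - k * (g.inv.act (1, 1)).1) (n - k * (g.inv.act (1, 1)).2) := by
  apply LinearEquiv.ext
  rintro ⟨⟨x, y⟩, z⟩
  cases g <;>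
  · rw [LinearEquiv.mul_apply, elt_apply, elt_apply]
    ext <;> simp [s_θ_apply, FinW.act, FinW.inv, FinW.lmulθ]
    all_goals ring

theorem elt_mul_s_θ (g : FinW) (m n k : ℤ) :
    (elt g m n : V' ≃ₗ[ℝ] V') * s ((1, 1), (k : ℝ)) = elt g.rmulθ (-n - k) (-m - k) := by
  apply LinearEquiv.ext
  rintro ⟨⟨x, y⟩, z⟩
  cases g <;>
  · rw [LinearEquiv.mul_apply, s_θ_apply, elt_apply, elt_apply]
    ext <;> simp [FinW.act, FinW.rmulθ]
    all_goals ring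

theorem translation_mul_elt (g : FinW) (m n p q : ℤ) :
    translation ((p : ℝ), (q : ℝ)) * (elt g m n : V' ≃ₗ[ℝ] V') =
      elt g (m + (g.inv.act (p, q)).1) (n + (g.inv.act (p, q)).2) := by
  apply LinearEquiv.ext
  rintro ⟨⟨x, y⟩, z⟩
  cases g <;>
  · rw [LinearEquiv.mul_apply, elt_apply, elt_apply]
    ext <;> simp [translation_apply, FinW.act, FinW.inv]
    all_goals ring

theorem elt_surjective (w : W) : ∃ g m n, w = elt g m n := by
  obtain ⟨w, hw⟩ := w
  suffices ∃ g m n, w = (elt g m n : V' ≃ₗ[ℝ] V') by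
    obtain ⟨g, m, n, h⟩ := this
    exact ⟨g, m, n, Subtype.ext h⟩
  have step : ∀ x ∈ {g | ∃ γ ∈ roots, g = s γ}, ∀ y : V' ≃ₗ[ℝ] V',
      (∃ g m n, y = (elt g m n : V' ≃ₗ[ℝ] V')) →
      ∃ g m n, x * y = (elt g m n : V' ≃ₗ[ℝ] V') := by
    rintro x hx _ ⟨g, m, n, rfl⟩
    obtain ⟨γ, hγ, k, rfl⟩ := reflection_iff.1 hx
    rcases hγ with rfl | rfl | rfl
    · exact ⟨_, _, _, s_α_mul_elt g m n k⟩
    · exact ⟨_, _, _, s_β_mul_elt g m n k⟩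
    · exact ⟨_, _, _, s_θ_mul_elt g m n k⟩
  induction hw using Subgroup.closure_induction_left with
  | one =>
    refine ⟨.e, 0, 0, LinearEquiv.ext ?_⟩
    rintro ⟨⟨x, y⟩, z⟩
    simp [elt_apply, FinW.act]
  | mul_left x hx y hy ih => exact step x hx y ih
  | inv_mul_cancel x hx y hy ih =>
    obtain ⟨γ, hγ, rfl⟩ := hx
    rw [s_inv]
    exact step _ ⟨γ, hγ, rfl⟩ y ih


theorem elt_inj {g g' : FinW} {m n m' n' : ℤ} :
    elt g m n = elt g' m' n' ↔ g = g' ∧ m = m' ∧ n = n' := by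
  refine ⟨fun h => ?_, by rintro ⟨rfl, rfl, rfl⟩; rfl⟩
  have h1 := congrArg (fun w : W => (w : V' ≃ₗ[ℝ] V') ((1, 0), 0)) h
  have h2 := congrArg (fun w : W => (w : V' ≃ₗ[ℝ] V') ((0, 1), 0)) h
  simp only [elt_apply, Prod.mk.injEq] at h1 h2
  obtain ⟨h1, h1'⟩ := h1
  obtain ⟨h2, h2'⟩ := h2
  have e1 : 2 * m - n = 2 * m' - n' := by
    have : (2 * m - n : ℝ) = 2 * m' - n' := by linarith
    exact_mod_cast this
  have e2 : 2 * n - m = 2 * n' - m' := by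
    have : (2 * n - m : ℝ) = 2 * n' - m' := by linarith
    exact_mod_cast this
  refine ⟨?_, by omega, by omega⟩
  have n1 : ¬ ((-1 : ℝ) = 0) := by norm_num
  have n2 : ¬ ((-1 : ℝ) = 1) := by norm_num
  have n3 : ¬ ((1 : ℝ) = -1) := by norm_num
  cases g <;> cases g' <;> first | rfl | (exfalso; simp [FinW.act, n2, n3] at h1 h2)

/-! ### Alcove coordinates -/

/-- The finite part of the element with coordinates `(a, b, ε)`, in terms of `j = a - b`: the class
of `j` modulo 3 and `ε` determine it. -/
def finPart (j : ℤ) (ε : Bool) : FinW :=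
  if j % 3 = 0 then (if ε then .aba else .e)
  else if j % 3 = 1 then (if ε then .b else .ab)
  else (if ε then .a else .ba)

/-- The element `w` with coordinates `(a, b, ε)`: those for which `w (α + k δ)`, `w (β + k δ)` and
`w (α + β + k δ)` are negative exactly when `k + a`, `k + b` and `k + a + b + ε` are, respectively
(see `alcove_apply_mem_negRoots`), with `ε` read as `0` or `1`. Equivalently, these are the signed
numbers of hyperplanes between the fundamental alcove and the alcove of `w⁻¹`. -/
def alcove (a b : ℤ) (ε : Bool) : W :=
  let g := finPart (a - b) ε
  elt g ((2 * (a + g.negα) + (b + g.negβ)) / 3) (((a + g.negα) + 2 * (b + g.negβ)) / 3)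

theorem finPart_eq (g : FinW) (m n : ℤ) :
    finPart (2 * m - n - g.negα - (2 * n - m - g.negβ)) g.odd = g := by
  cases g <;> unfold finPart <;> split_ifs with h1 h2 h3 <;>
    simp_all only [FinW.negα, FinW.negβ, FinW.odd] <;> first | contradiction | omega

theorem elt_eq_alcove (g : FinW) (m n : ℤ) :
    elt g m n = alcove (2 * m - n - g.negα) (2 * n - m - g.negβ) g.odd := by
  simp only [alcove]
  rw [finPart_eq, elt_inj]
  exact ⟨rfl, by omega, by omega⟩

theorem exists_elt_coords (a b : ℤ) (ε : Bool) :
    ∃ g m n, a = 2 * m - n - FinW.negα g ∧ b = 2 * n - m - FinW.negβ g ∧ ε = FinW.odd g := by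
  have h : (a - b) % 3 = 0 ∨ (a - b) % 3 = 1 ∨ (a - b) % 3 = 2 := by omega
  cases ε <;> rcases h with h | h | h
  · exact ⟨.e, (2 * a + b) / 3, (a + 2 * b) / 3, by simp [FinW.negα]; omega,
      by simp [FinW.negβ]; omega, rfl⟩
  · exact ⟨.ab, (2 * a + b + 1) / 3, (a + 2 * b + 2) / 3, by simp [FinW.negα]; omega,
      by simp [FinW.negβ]; omega, rfl⟩
  · exact ⟨.ba, (2 * a + b + 2) / 3, (a + 2 * b + 1) / 3, by simp [FinW.negα]; omega,
      by simp [FinW.negβ]; omega, rfl⟩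
  · exact ⟨.aba, (2 * a + b) / 3 + 1, (a + 2 * b) / 3 + 1, by simp [FinW.negα]; omega,
      by simp [FinW.negβ]; omega, rfl⟩
  · exact ⟨.b, (2 * a + b + 1) / 3, (a + 2 * b + 2) / 3, by simp [FinW.negα]; omega,
      by simp [FinW.negβ]; omega, rfl⟩
  · exact ⟨.a, (2 * a + b + 2) / 3, (a + 2 * b + 1) / 3, by simp [FinW.negα]; omega,
      by simp [FinW.negβ]; omega, rfl⟩

theorem alcove_surjective (w : W) : ∃ a b ε, w = alcove a b ε := by
  obtain ⟨g, m, n, rfl⟩ := elt_surjective w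
  exact ⟨_, _, _, elt_eq_alcove g m n⟩

theorem alcove_inj {a b a' b' : ℤ} {ε ε' : Bool} :
    alcove a b ε = alcove a' b' ε' ↔ a = a' ∧ b = b' ∧ ε = ε' := by
  refine ⟨fun h => ?_, by rintro ⟨rfl, rfl, rfl⟩; rfl⟩
  obtain ⟨g, m, n, rfl, rfl, rfl⟩ := exists_elt_coords a b ε
  obtain ⟨g', m', n', rfl, rfl, rfl⟩ := exists_elt_coords a' b' ε'
  rw [← elt_eq_alcove, ← elt_eq_alcove, elt_inj] at h
  obtain ⟨rfl, rfl, rfl⟩ := h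
  simp

/-- The alcove coordinates as a bijection. -/
def coords : ℤ × ℤ × Bool ≃ W :=
  Equiv.ofBijective (fun x => alcove x.1 x.2.1 x.2.2)
    ⟨fun ⟨a, b, ε⟩ ⟨a', b', ε'⟩ h => by
      obtain ⟨h1, h2, h3⟩ := alcove_inj.1 h
      simp_all, fun w => by
      obtain ⟨a, b, ε, rfl⟩ := alcove_surjective w
      exact ⟨(a, b, ε), rfl⟩⟩

theorem alcove_one : alcove 0 0 false = 1 := by
  have h := elt_eq_alcove .e 0 0
  simp only [FinW.negα, FinW.negβ, FinW.odd] at h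
  norm_num at h
  rw [← h]
  apply W_ext
  intro a b c
  simp [elt_apply, FinW.act]

theorem sα_mul_elt (g : FinW) (m n : ℤ) : sα * elt g m n = elt g.lmulα m n := by
  apply Subtype.ext
  rw [Subgroup.coe_mul, sα_coe]
  simpa using s_α_mul_elt g m n 0

theorem sβ_mul_elt (g : FinW) (m n : ℤ) : sβ * elt g m n = elt g.lmulβ m n := by
  apply Subtype.ext
  rw [Subgroup.coe_mul, sβ_coe]
  simpa using s_β_mul_elt g m n 0

theorem s₀_mul_elt (g : FinW) (m n : ℤ) :
    s₀ * elt g m n = elt g.lmulθ (m + (g.inv.act (1, 1)).1) (n + (g.inv.act (1, 1)).2) := by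
  apply Subtype.ext
  rw [Subgroup.coe_mul, s₀_coe]
  simpa using s_θ_mul_elt g m n (-1)

/-- The simple reflections indexed cyclically modulo 3, in the order in which they occur in
`(s_β s_{δ-α-β} s_α)^∞`. -/
def letter (k : ℤ) : W := if k % 3 = 0 then sβ else if k % 3 = 1 then s₀ else sα

theorem letter_zero {k : ℤ} (h : k % 3 = 0) : letter k = sβ := by simp [letter, h]
theorem letter_one {k : ℤ} (h : k % 3 = 1) : letter k = s₀ := by simp [letter, h]
theorem letter_two {k : ℤ} (h : k % 3 = 2) : letter k = sα := by simp [letter, h]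

/-- Left multiplication by a simple reflection crosses one wall of the alcove. The class of `a - b`
modulo 3 is the colouring that decides which simple reflection belongs to which wall. -/
theorem letter_mul_alcove (a b k : ℤ) (ε : Bool) :
    letter k * alcove a b ε =
      if (k - (a - b)) % 3 = 0 then (bif ε then alcove (a + 1) b false else alcove a (b - 1) true)
      else if (k - (a - b)) % 3 = 1 then alcove a b !ε
      else (bif ε then alcove a (b + 1) false else alcove (a - 1) b true) := by
  obtain ⟨g, m, n, rfl, rfl, rfl⟩ := exists_elt_coords a b ε
  rw [← elt_eq_alcove]
  have hk : k % 3 = 0 ∨ k % 3 = 1 ∨ k % 3 = 2 := by omega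
  rcases hk with hk | hk | hk
  · rw [letter_zero hk, sβ_mul_elt, elt_eq_alcove]
    cases g <;> simp only [FinW.negα, FinW.negβ, FinW.odd, FinW.lmulβ, cond_true, cond_false,
      Bool.not_true, Bool.not_false]
    all_goals split_ifs <;> first | omega | simp
  · rw [letter_one hk, s₀_mul_elt, elt_eq_alcove]
    cases g <;> simp only [FinW.negα, FinW.negβ, FinW.odd, FinW.lmulθ, cond_true, cond_false,
      Bool.not_true, Bool.not_false, FinW.inv, FinW.act]
    all_goals split_ifs <;>
      first | omega | (simp [alcove_inj]; done) | (simp only [alcove_inj, and_true]; omega)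
  · rw [letter_two hk, sα_mul_elt, elt_eq_alcove]
    cases g <;> simp only [FinW.negα, FinW.negβ, FinW.odd, FinW.lmulα, cond_true, cond_false,
      Bool.not_true, Bool.not_false]
    all_goals split_ifs <;> first | omega | simp

/-- Right multiplication acts on the alcoves by isometries; here by a reflection in a hyperplane
of direction `α + β`. -/
theorem alcove_mul_s_θ {a b k : ℤ} {ε : Bool} {t : W}
    (ht : (t : V' ≃ₗ[ℝ] V') = s ((1, 1), (k : ℝ))) :
    alcove a b ε * t = alcove (-b - 1 - k) (-a - 1 - k) !ε := by
  obtain ⟨g, m, n, rfl, rfl, rfl⟩ := exists_elt_coords a b ε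
  rw [← elt_eq_alcove]
  have h : elt g m n * t = elt g.rmulθ (-n - k) (-m - k) := by
    apply Subtype.ext
    rw [Subgroup.coe_mul, ht, elt_mul_s_θ]
  rw [h, elt_eq_alcove, alcove_inj]
  cases g <;> simp [FinW.negα, FinW.negβ, FinW.odd, FinW.rmulθ] <;> omega

theorem alcove_mul_u (a b : ℤ) (ε : Bool) : alcove a b ε * u = alcove (-b - 1) (-a - 1) !ε := by
  rw [alcove_mul_s_θ u_coe]
  simp

theorem alcove_mul_v (a b : ℤ) (ε : Bool) : alcove a b ε * v = alcove (-b) (-a) !ε := by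
  rw [v, alcove_mul_s_θ s₀_coe]
  simp

/-! ### Signs of roots -/

theorem mem_posRoots_of_finPos {γ : V} (hγ : γ ∈ finPos) (k : ℤ) :
    ((γ, (k : ℝ)) : V') ∈ posRoots ↔ 0 ≤ k := by
  constructor
  · rintro ⟨γ', -, n, ⟨-, h⟩ | ⟨h', h⟩⟩
    · have : (k : ℝ) = n := congrArg Prod.snd h
      have : k = n := by exact_mod_cast this
      omega
    · exfalso
      have : γ = γ' := congrArg Prod.fst h
      subst this
      rw [Set.mem_neg] at h'
      have n1 : ¬ ((-1 : ℝ) = 1) := by norm_num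
      rcases hγ with rfl | rfl | rfl <;> simp [finPos, n1] at h'
  · intro hk
    lift k to ℕ using hk
    exact ⟨γ, Or.inl hγ, k, Or.inl ⟨hγ, by simp⟩⟩

theorem mem_posRoots_neg_of_finPos {γ : V} (hγ : γ ∈ finPos) (k : ℤ) :
    ((-γ, (k : ℝ)) : V') ∈ posRoots ↔ 1 ≤ k := by
  constructor
  · rintro ⟨γ', -, n, ⟨h', h⟩ | ⟨-, h⟩⟩
    · exfalso
      have : -γ = γ' := congrArg Prod.fst h
      subst this
      have n1 : ¬ ((-1 : ℝ) = 1) := by norm_num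
      rcases hγ with rfl | rfl | rfl <;> simp [finPos, n1] at h'
    · have : (k : ℝ) = n + 1 := congrArg Prod.snd h
      have : k = n + 1 := by exact_mod_cast this
      omega
  · intro hk
    obtain ⟨n, rfl⟩ : ∃ n : ℕ, k = n + 1 := ⟨(k - 1).toNat, by omega⟩
    exact ⟨-γ, Or.inr (by simpa using hγ), n, Or.inr ⟨by simpa using hγ, by simp⟩⟩

theorem mem_negRoots_of_finPos {γ : V} (hγ : γ ∈ finPos) (k : ℤ) :
    ((γ, (k : ℝ)) : V') ∈ negRoots ↔ k < 0 := by
  have h := mem_posRoots_neg_of_finPos hγ (-k)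
  rw [negRoots, Set.mem_neg, Prod.neg_mk, ← Int.cast_neg, h]
  omega

theorem mem_negRoots_neg_of_finPos {γ : V} (hγ : γ ∈ finPos) (k : ℤ) :
    ((-γ, (k : ℝ)) : V') ∈ negRoots ↔ k ≤ 0 := by
  have h := mem_posRoots_of_finPos hγ (-k)
  rw [negRoots, Set.mem_neg, Prod.neg_mk, ← Int.cast_neg, neg_neg, h]
  omega

/-- The coordinate `d_γ` of the element `alcove a b ε` for a positive root `γ` of the finite root
system; on vectors other than `α` and `β` the value is that for `α + β`. -/
def crossing (a b : ℤ) (ε : Bool) (γ : V) : ℤ :=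
  open Classical in
  if γ = (1, 0) then a else if γ = (0, 1) then b else a + b + bif ε then 1 else 0

theorem crossing_α (a b : ℤ) (ε : Bool) : crossing a b ε (1, 0) = a := by
  simp [crossing]

theorem crossing_β (a b : ℤ) (ε : Bool) : crossing a b ε (0, 1) = b := by
  simp [crossing]

theorem crossing_θ (a b : ℤ) (ε : Bool) :
    crossing a b ε (1, 1) = a + b + bif ε then 1 else 0 := by
  simp [crossing]

theorem alcove_apply_mem_negRoots {γ : V} (hγ : γ ∈ finPos) (a b k : ℤ) (ε : Bool) :
    (alcove a b ε : V' ≃ₗ[ℝ] V') (γ, (k : ℝ)) ∈ negRoots ↔ k + crossing a b ε γ < 0 := by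
  obtain ⟨g, m, n, rfl, rfl, rfl⟩ := exists_elt_coords a b ε
  rw [← elt_eq_alcove]
  have pα : ((1, 0) : V) ∈ finPos := by simp [finPos]
  have pβ : ((0, 1) : V) ∈ finPos := by simp [finPos]
  have pθ : ((1, 1) : V) ∈ finPos := by simp [finPos]
  have hα := mem_negRoots_of_finPos pα
  have hα' := mem_negRoots_neg_of_finPos pα
  have hβ := mem_negRoots_of_finPos pβ
  have hβ' := mem_negRoots_neg_of_finPos pβ
  have hθ := mem_negRoots_of_finPos pθ
  have hθ' := mem_negRoots_neg_of_finPos pθ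
  have e1 : (2 * m - n : ℝ) = ((2 * m - n : ℤ) : ℝ) := by push_cast; ring
  have e2 : (2 * n - m : ℝ) = ((2 * n - m : ℤ) : ℝ) := by push_cast; ring
  simp only [Prod.neg_mk, neg_zero] at hα' hβ' hθ'
  rcases hγ with rfl | rfl | rfl
  · rw [crossing_α, elt_apply, mul_one, mul_zero, add_zero, e1, ← Int.cast_add]
    cases g <;> simp only [FinW.act, FinW.negα, sub_zero, zero_sub, neg_zero,
      hα, hα', hβ, hβ', hθ, hθ'] <;> omega
  · rw [crossing_β, elt_apply, mul_one, mul_zero, zero_add, e2, ← Int.cast_add]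
    cases g <;> simp only [FinW.act, FinW.negβ, sub_zero, zero_sub, neg_zero,
      hα, hα', hβ, hβ', hθ, hθ'] <;> omega
  · rw [crossing_θ, elt_apply, mul_one, mul_one, e1, e2, ← Int.cast_add, ← Int.cast_add]
    cases g <;> simp only [FinW.act, FinW.negα, FinW.negβ, FinW.odd, sub_zero, sub_self,
      cond_true, cond_false, hα, hα', hβ, hβ', hθ, hθ'] <;> omega

theorem alcove_apply_neg_mem_negRoots {γ : V} (hγ : γ ∈ finPos) (a b k : ℤ) (ε : Bool) :
    (alcove a b ε : V' ≃ₗ[ℝ] V') (-γ, (k : ℝ)) ∈ negRoots ↔ k ≤ crossing a b ε γ := by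
  obtain ⟨g, m, n, rfl, rfl, rfl⟩ := exists_elt_coords a b ε
  rw [← elt_eq_alcove]
  have pα : ((1, 0) : V) ∈ finPos := by simp [finPos]
  have pβ : ((0, 1) : V) ∈ finPos := by simp [finPos]
  have pθ : ((1, 1) : V) ∈ finPos := by simp [finPos]
  have hα := mem_negRoots_of_finPos pα
  have hα' := mem_negRoots_neg_of_finPos pα
  have hβ := mem_negRoots_of_finPos pβ
  have hβ' := mem_negRoots_neg_of_finPos pβ
  have hθ := mem_negRoots_of_finPos pθ
  have hθ' := mem_negRoots_neg_of_finPos pθ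
  have e1 : (2 * m - n : ℝ) = ((2 * m - n : ℤ) : ℝ) := by push_cast; ring
  have e2 : (2 * n - m : ℝ) = ((2 * n - m : ℤ) : ℝ) := by push_cast; ring
  simp only [Prod.neg_mk, neg_zero] at hα' hβ' hθ'
  rcases hγ with rfl | rfl | rfl <;> simp only [Prod.neg_mk, neg_zero]
  · rw [crossing_α, elt_apply, mul_neg_one, mul_zero, add_zero, e1, ← Int.cast_neg, ← Int.cast_add]
    cases g <;> simp only [FinW.act, FinW.negα, sub_zero, neg_zero, neg_neg, sub_neg_eq_add,
      zero_add, hα, hα', hβ, hβ', hθ, hθ'] <;> omega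
  · rw [crossing_β, elt_apply, mul_neg_one, mul_zero, zero_add, e2, ← Int.cast_neg, ← Int.cast_add]
    cases g <;> simp only [FinW.act, FinW.negβ, sub_zero, neg_zero, neg_neg, sub_neg_eq_add,
      zero_add, hα, hα', hβ, hβ', hθ, hθ'] <;> omega
  · rw [crossing_θ, elt_apply, mul_neg_one, mul_neg_one, e1, e2,
      ← Int.cast_neg, ← Int.cast_neg, ← Int.cast_add, ← Int.cast_add]
    cases g <;> simp only [FinW.act, FinW.negα, FinW.negβ, FinW.odd, sub_zero, sub_self, neg_neg,
      cond_true, cond_false, hα, hα', hβ, hβ', hθ, hθ'] <;> omega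


/-! ### The length function -/

theorem mem_S_iff {r : W} : r ∈ S ↔ ∃ k : ℤ, r = letter k := by
  constructor
  · rintro (rfl | rfl | rfl)
    exacts [⟨2, rfl⟩, ⟨0, rfl⟩, ⟨1, rfl⟩]
  · rintro ⟨k, rfl⟩
    unfold letter S
    split_ifs <;> simp

theorem letter_mem_S (k : ℤ) : letter k ∈ S := mem_S_iff.2 ⟨k, rfl⟩

/-- The number of hyperplanes separating the alcove with coordinates `(a, b, ε)` from the
fundamental one. It equals the length, see `length_alcove`. -/
def hyperplaneCount (a b : ℤ) (ε : Bool) : ℕ :=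
  a.natAbs + b.natAbs + (a + b + bif ε then 1 else 0).natAbs

theorem exists_letter_mul_eq (k a b : ℤ) (ε : Bool) : ∃ a' b' ε',
    letter k * alcove a b ε = alcove a' b' ε' ∧
      hyperplaneCount a' b' ε' ≤ hyperplaneCount a b ε + 1 := by
  rw [letter_mul_alcove]
  unfold hyperplaneCount
  split_ifs <;> cases ε <;> refine ⟨_, _, _, rfl, ?_⟩ <;> simp <;> omega

theorem hyperplaneCount_le {L : List W} (hL : ∀ r ∈ L, r ∈ S) : ∃ a b ε,
    L.prod = alcove a b ε ∧ hyperplaneCount a b ε ≤ L.length := by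
  induction L with
  | nil => exact ⟨0, 0, false, alcove_one.symm, by simp [hyperplaneCount]⟩
  | cons r L ih =>
    obtain ⟨a, b, ε, h, h'⟩ := ih fun x hx => hL x (List.mem_cons_of_mem _ hx)
    obtain ⟨k, rfl⟩ := mem_S_iff.1 (hL r List.mem_cons_self)
    obtain ⟨a', b', ε', e, e'⟩ := exists_letter_mul_eq k a b ε
    exact ⟨a', b', ε', by rw [List.prod_cons, h, e], by rw [List.length_cons]; omega⟩

/-- An element other than the identity has a left descent. -/
theorem exists_letter_mul_lt {a b : ℤ} {ε : Bool} {n : ℕ} (h : hyperplaneCount a b ε = n + 1) :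
    ∃ k a' b' ε', alcove a b ε = letter k * alcove a' b' ε' ∧ hyperplaneCount a' b' ε' = n := by
  have key : ∀ k a' b' ε', letter k * alcove a' b' ε' = alcove a b ε →
      hyperplaneCount a' b' ε' = n →
      ∃ k a' b' ε', alcove a b ε = letter k * alcove a' b' ε' ∧ hyperplaneCount a' b' ε' = n :=
    fun k a' b' ε' h h' => ⟨k, a', b', ε', h.symm, h'⟩
  unfold hyperplaneCount at h key
  cases ε
  · simp only [cond_false, add_zero] at h
    by_cases h1 : 0 < a
    · refine key (a - b - 1) (a - 1) b true ?_ (by simp only [cond_true]; omega)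
      rw [letter_mul_alcove, if_pos (by omega)]; simp
    by_cases h2 : 0 < b
    · refine key (a - b) a (b - 1) true ?_ (by simp only [cond_true]; omega)
      rw [letter_mul_alcove, if_neg (by omega), if_neg (by omega)]; simp
    · refine key (a - b + 1) a b true ?_ (by simp only [cond_true]; omega)
      rw [letter_mul_alcove, if_neg (by omega), if_pos (by omega)]; simp
  · simp only [cond_true] at h
    by_cases h1 : a < 0
    · refine key (a - b) (a + 1) b false ?_ (by simp only [cond_false]; omega)
      rw [letter_mul_alcove, if_neg (by omega), if_neg (by omega)]; simp
    by_cases h2 : b < 0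
    · refine key (a - b - 1) a (b + 1) false ?_ (by simp only [cond_false]; omega)
      rw [letter_mul_alcove, if_pos (by omega)]; simp
    · refine key (a - b + 1) a b false ?_ (by simp only [cond_false]; omega)
      rw [letter_mul_alcove, if_neg (by omega), if_pos (by omega)]; simp

theorem exists_word (n : ℕ) : ∀ a b ε, hyperplaneCount a b ε = n →
    ∃ L : List W, (∀ r ∈ L, r ∈ S) ∧ L.prod = alcove a b ε ∧ L.length = n := by
  induction n with
  | zero =>
    intro a b ε h
    refine ⟨[], by simp, ?_, rfl⟩
    unfold hyperplaneCount at h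
    cases ε <;> simp only [cond_true, cond_false] at h
    · obtain rfl : a = 0 := by omega
      obtain rfl : b = 0 := by omega
      exact alcove_one.symm
    · omega
  | succ n ih =>
    intro a b ε h
    obtain ⟨k, a', b', ε', e, h'⟩ := exists_letter_mul_lt h
    obtain ⟨L, h1, h2, h3⟩ := ih a' b' ε' h'
    refine ⟨letter k :: L, ?_, by rw [List.prod_cons, h2, e], by rw [List.length_cons, h3]⟩
    intro r hr
    rcases List.mem_cons.1 hr with rfl | hr
    exacts [letter_mem_S k, h1 r hr]

theorem length_alcove (a b : ℤ) (ε : Bool) : length (alcove a b ε) = hyperplaneCount a b ε := by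
  apply le_antisymm
  · exact Nat.sInf_le (exists_word _ a b ε rfl)
  · refine le_csInf ⟨_, exists_word _ a b ε rfl⟩ ?_
    rintro n ⟨L, h1, h2, rfl⟩
    obtain ⟨a', b', ε', e, h⟩ := hyperplaneCount_le h1
    rw [h2, alcove_inj] at e
    obtain ⟨rfl, rfl, rfl⟩ := e
    exact h

theorem length_inv (w : W) : length w⁻¹ = length w := by
  have key : ∀ w : W, {n | ∃ L : List W, (∀ r ∈ L, r ∈ S) ∧ L.prod = w ∧ L.length = n} ⊆
      {n | ∃ L : List W, (∀ r ∈ L, r ∈ S) ∧ L.prod = w⁻¹ ∧ L.length = n} := by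
    rintro w n ⟨L, h, rfl, rfl⟩
    refine ⟨(L.map fun x => x⁻¹).reverse, ?_, (List.prod_inv_reverse L).symm, by simp⟩
    intro r hr
    obtain ⟨x, hx, rfl⟩ := List.mem_map.1 (List.mem_reverse.1 hr)
    have e : x⁻¹ = x := by
      apply Subtype.ext
      rw [Subgroup.coe_inv]
      rcases h x hx with rfl | rfl | rfl <;> exact s_inv _
    rw [e]
    exact h x hx
  unfold length
  congr 1
  apply subset_antisymm
  · simpa using key w⁻¹
  · exact key w

/-! ### The twisted length -/

theorem ncard_ray (γ : V) (d : ℕ) :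
    ((fun n : ℕ => ((γ, (n : ℝ)) : V')) '' (Finset.range d : Set ℕ)).ncard = d := by
  rw [Set.ncard_image_of_injective, Set.ncard_coe_finset, Finset.card_range]
  intro m n h
  simpa using h

/-- The inversions in `B` are the `γ + n δ` with `0 ≤ n < -d_γ`. -/
theorem N_inter_B (a b : ℤ) (ε : Bool) :
    N (alcove a b ε)⁻¹ ∩ B = ⋃ γ ∈ finPos,
      ((fun n : ℕ => ((γ, (n : ℝ)) : V')) '' (Finset.range (-crossing a b ε γ).toNat : Set ℕ)) := by
  ext x
  simp only [N, inv_inv, Set.mem_inter_iff, Set.mem_ofPred_eq, Set.mem_iUnion, Set.mem_image,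
    Finset.mem_coe, Finset.mem_range, exists_prop]
  constructor
  · rintro ⟨⟨-, h⟩, γ, hγ, n, ⟨-, rfl⟩ | ⟨h', rfl⟩⟩
    · refine ⟨γ, hγ, n, ?_, rfl⟩
      have := (alcove_apply_mem_negRoots hγ a b n ε).1 (by simpa using h)
      omega
    · exfalso
      rw [Set.mem_neg] at h'
      have n1 : ¬ ((-1 : ℝ) = 1) := by norm_num
      rcases hγ with rfl | rfl | rfl <;> simp [finPos, n1] at h'
  · rintro ⟨γ, hγ, n, hn, rfl⟩
    refine ⟨⟨?_, ?_⟩, γ, hγ, n, Or.inl ⟨hγ, rfl⟩⟩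
    · simpa using mem_posRoots_of_finPos hγ n
    · simpa using (alcove_apply_mem_negRoots hγ a b n ε).2 (by omega)

/-- The length is `∑ |d_γ|`, and `l_B` subtracts `2 max (0, -d_γ)` for each `γ`, so the absolute
values disappear. -/
theorem lB_alcove (a b : ℤ) (ε : Bool) : lB (alcove a b ε) = 2 * (a + b) + bif ε then 1 else 0 := by
  have disj : ∀ γ γ' : V, γ ≠ γ' → ∀ d d' : ℕ, Disjoint
      ((fun n : ℕ => ((γ, (n : ℝ)) : V')) '' (Finset.range d : Set ℕ))
      ((fun n : ℕ => ((γ', (n : ℝ)) : V')) '' (Finset.range d' : Set ℕ)) := by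
    intro γ γ' hne d d'
    rw [Set.disjoint_left]
    rintro _ ⟨n, -, rfl⟩ ⟨m, -, h⟩
    exact hne (congrArg Prod.fst h).symm
  have hcard : (N (alcove a b ε)⁻¹ ∩ B).ncard = (-a).toNat + ((-b).toNat +
      (-(a + b + bif ε then 1 else 0)).toNat) := by
    rw [N_inter_B]
    simp only [finPos, Set.mem_insert_iff, Set.mem_singleton_iff, Set.iUnion_iUnion_eq_or_left,
      Set.iUnion_iUnion_eq_left]
    rw [Set.ncard_union_eq, Set.ncard_union_eq, ncard_ray, ncard_ray, ncard_ray, crossing_α,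
      crossing_β, crossing_θ]
    · exact disj _ _ (by simp) _ _
    · exact Disjoint.union_right (disj _ _ (by simp) _ _) (disj _ _ (by simp) _ _)
  rw [lB, twistedLength, hcard, length_alcove]
  unfold hyperplaneCount
  cases ε <;> simp only [cond_true, cond_false] <;> omega

/-! ### Covering relations -/

/-- The covering relation of the alcove order; `leB` is its reflexive transitive closure by
definition. -/
def Covers (x y : W) : Prop := ∃ t ∈ reflections, y = t * x ∧ lB y = lB x + 1

theorem letter_mem_reflections (k : ℤ) : letter k ∈ reflections := by
  rcases letter_mem_S k with h | h | h
  · exact ⟨α, α_mem, by rw [h]; rfl⟩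
  · exact ⟨β, β_mem, by rw [h]; rfl⟩
  · exact ⟨_, δ_sub_mem, by rw [h]; rfl⟩

theorem conj_letter_mem_reflections {k l : ℤ} (h : (k - l) % 3 ≠ 0) :
    letter k * letter l * letter k ∈ reflections := by
  have h1 : ∀ i j : ℤ, (∃ γ ∈ finPos, ∃ m : ℤ,
      (letter i : V' ≃ₗ[ℝ] V') * letter j * letter i = s (γ, (m : ℝ))) →
      letter i * letter j * letter i ∈ reflections := fun i j h => by
    obtain ⟨γ, hγ, e⟩ := reflection_iff.2 h
    exact ⟨γ, hγ, by simpa using e⟩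
  apply h1
  have hk : k % 3 = 0 ∨ k % 3 = 1 ∨ k % 3 = 2 := by omega
  have hl : l % 3 = 0 ∨ l % 3 = 1 ∨ l % 3 = 2 := by omega
  rcases hk with hk | hk | hk <;> rcases hl with hl | hl | hl
  · omega
  · refine ⟨(1, 0), by simp [finPos], -1, LinearEquiv.ext fun ⟨⟨x, y⟩, z⟩ => ?_⟩
    rw [letter_zero hk, letter_one hl]
    simp only [LinearEquiv.mul_apply, sβ_coe, s₀_coe, s_β_apply, s_θ_apply, s_α_apply]
    ext <;> simp <;> ring
  · refine ⟨(1, 1), by simp [finPos], 0, LinearEquiv.ext fun ⟨⟨x, y⟩, z⟩ => ?_⟩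
    rw [letter_zero hk, letter_two hl]
    simp only [LinearEquiv.mul_apply, sβ_coe, sα_coe, s_β_apply, s_θ_apply, s_α_apply]
    ext <;> simp <;> ring
  · refine ⟨(1, 0), by simp [finPos], -1, LinearEquiv.ext fun ⟨⟨x, y⟩, z⟩ => ?_⟩
    rw [letter_one hk, letter_zero hl]
    simp only [LinearEquiv.mul_apply, s₀_coe, sβ_coe, s_β_apply, s_θ_apply, s_α_apply]
    ext <;> simp <;> ring
  · omega
  · refine ⟨(0, 1), by simp [finPos], -1, LinearEquiv.ext fun ⟨⟨x, y⟩, z⟩ => ?_⟩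
    rw [letter_one hk, letter_two hl]
    simp only [LinearEquiv.mul_apply, s₀_coe, sα_coe, s_β_apply, s_θ_apply, s_α_apply]
    ext <;> simp <;> ring
  · refine ⟨(1, 1), by simp [finPos], 0, LinearEquiv.ext fun ⟨⟨x, y⟩, z⟩ => ?_⟩
    rw [letter_two hk, letter_zero hl]
    simp only [LinearEquiv.mul_apply, sα_coe, sβ_coe, s_β_apply, s_θ_apply, s_α_apply]
    ext <;> simp <;> ring
  · refine ⟨(0, 1), by simp [finPos], -1, LinearEquiv.ext fun ⟨⟨x, y⟩, z⟩ => ?_⟩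
    rw [letter_two hk, letter_one hl]
    simp only [LinearEquiv.mul_apply, sα_coe, s₀_coe, s_β_apply, s_θ_apply, s_α_apply]
    ext <;> simp <;> ring
  · omega

/-- A reflection in a given finite direction raises `l_B` by one for at most one hyperplane of that
direction, which leaves at most three candidates above each element. -/
theorem covers_of_reflection {t : W} (ht : t ∈ reflections) {a b : ℤ} {ε : Bool}
    (h : lB (t * alcove a b ε) = lB (alcove a b ε) + 1) :
    t * alcove a b ε ∈ (bif ε then ({alcove (a + 1) b false, alcove a (b + 1) false} : Set W) else
      {alcove (a + 1) (b - 1) true, alcove a b true, alcove (a - 1) (b + 1) true}) := by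
  obtain ⟨γ, hγ, k, ht⟩ := reflection_iff.1 ht
  obtain ⟨g, m, n, rfl, rfl, rfl⟩ := exists_elt_coords a b ε
  rw [← elt_eq_alcove] at h ⊢
  have key : ∀ g' m' n', (t : V' ≃ₗ[ℝ] V') * elt g m n = elt g' m' n' →
      t * elt g m n = elt g' m' n' := fun g' m' n' h => Subtype.ext h
  rw [ht] at key
  rcases hγ with rfl | rfl | rfl
  · rw [key _ _ _ (s_α_mul_elt g m n k), elt_eq_alcove] at h ⊢
    rw [elt_eq_alcove, lB_alcove, lB_alcove] at h
    cases g <;>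
    simp [FinW.negα, FinW.negβ, FinW.odd, FinW.lmulα, FinW.inv, FinW.act, alcove_inj] at h ⊢ <;>
    omega
  · rw [key _ _ _ (s_β_mul_elt g m n k), elt_eq_alcove] at h ⊢
    rw [elt_eq_alcove, lB_alcove, lB_alcove] at h
    cases g <;>
    simp [FinW.negα, FinW.negβ, FinW.odd, FinW.lmulβ, FinW.inv, FinW.act, alcove_inj] at h ⊢ <;>
    omega
  · rw [key _ _ _ (s_θ_mul_elt g m n k), elt_eq_alcove] at h ⊢
    rw [elt_eq_alcove, lB_alcove, lB_alcove] at h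
    cases g <;>
    simp [FinW.negα, FinW.negβ, FinW.odd, FinW.lmulθ, FinW.inv, FinW.act, alcove_inj] at h ⊢ <;>
    omega

/-! Instances of `letter_mul_alcove`, named by `ε` and the residue of `k - (a - b)`. -/

theorem letter_mul_alcove_false_zero {k a b : ℤ} (h : (k - (a - b)) % 3 = 0) :
    letter k * alcove a b false = alcove a (b - 1) true := by
  rw [letter_mul_alcove, if_pos h]; rfl

theorem letter_mul_alcove_false_two {k a b : ℤ} (h : (k - (a - b)) % 3 = 2) :
    letter k * alcove a b false = alcove (a - 1) b true := by
  rw [letter_mul_alcove, if_neg (by omega), if_neg (by omega)]; rfl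

theorem letter_mul_alcove_false_one {k a b : ℤ} (h : (k - (a - b)) % 3 = 1) :
    letter k * alcove a b false = alcove a b true := by
  rw [letter_mul_alcove, if_neg (by omega), if_pos (by omega)]; rfl

theorem letter_mul_alcove_true_zero {k a b : ℤ} (h : (k - (a - b)) % 3 = 0) :
    letter k * alcove a b true = alcove (a + 1) b false := by
  rw [letter_mul_alcove, if_pos h]; rfl

theorem letter_mul_alcove_true_two {k a b : ℤ} (h : (k - (a - b)) % 3 = 2) :
    letter k * alcove a b true = alcove a (b + 1) false := by
  rw [letter_mul_alcove, if_neg (by omega), if_neg (by omega)]; rfl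

/-- The cover `(a, b, 1)` of `(a, b, 0)` is an adjacent alcove; the other two are at distance 3 and
are obtained by the reflections `r r' r` with `r`, `r'` simple. -/
theorem covers_false_iff {a b : ℤ} {y : W} : Covers (alcove a b false) y ↔
    y = alcove (a + 1) (b - 1) true ∨ y = alcove a b true ∨ y = alcove (a - 1) (b + 1) true := by
  constructor
  · rintro ⟨t, ht, rfl, h⟩
    exact covers_of_reflection ht h
  · rintro (rfl | rfl | rfl)
    · refine ⟨_, conj_letter_mem_reflections (k := a - b) (l := a - b + 1) (by omega), ?_, ?_⟩
      · rw [mul_assoc, mul_assoc, letter_mul_alcove_false_zero (by omega),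
          letter_mul_alcove_true_zero (by omega), letter_mul_alcove_false_one (by omega)]
      · simp only [lB_alcove, cond_true, cond_false]; ring
    · refine ⟨_, letter_mem_reflections (a - b + 1), ?_, ?_⟩
      · rw [letter_mul_alcove_false_one (by omega)]
      · simp only [lB_alcove, cond_true, cond_false]; ring
    · refine ⟨_, conj_letter_mem_reflections (k := a - b - 1) (l := a - b - 2) (by omega), ?_, ?_⟩
      · rw [mul_assoc, mul_assoc, letter_mul_alcove_false_two (by omega),
          letter_mul_alcove_true_two (by omega), letter_mul_alcove_false_one (by omega)]
      · simp only [lB_alcove, cond_true, cond_false]; ring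

theorem covers_true_iff {a b : ℤ} {y : W} : Covers (alcove a b true) y ↔
    y = alcove (a + 1) b false ∨ y = alcove a (b + 1) false := by
  constructor
  · rintro ⟨t, ht, rfl, h⟩
    exact covers_of_reflection ht h
  · rintro (rfl | rfl)
    · refine ⟨_, letter_mem_reflections (a - b), ?_, ?_⟩
      · rw [letter_mul_alcove_true_zero (by omega)]
      · simp only [lB_alcove, cond_true, cond_false]; ring
    · refine ⟨_, letter_mem_reflections (a - b - 1), ?_, ?_⟩
      · rw [letter_mul_alcove_true_two (by omega)]
      · simp only [lB_alcove, cond_true, cond_false]; ring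


/-! ### Intervals of length 2 and 3 -/

theorem covers_alcove_alcove {a b a' b' : ℤ} {ε ε' : Bool} :
    Covers (alcove a b ε) (alcove a' b' ε') ↔
    ε ≠ ε' ∧ bif ε then a' = a + 1 ∧ b' = b ∨ a' = a ∧ b' = b + 1
      else a' = a + 1 ∧ b' = b - 1 ∨ a' = a ∧ b' = b ∨ a' = a - 1 ∧ b' = b + 1 := by
  cases ε <;> cases ε' <;> simp [covers_false_iff, covers_true_iff, alcove_inj]

theorem Covers.lB_eq {x y : W} (h : Covers x y) : lB y = lB x + 1 := by
  obtain ⟨t, -, -, h⟩ := h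
  exact h

theorem Covers.leB {x y : W} (h : Covers x y) : leB x y := Relation.ReflTransGen.single h

theorem leB_refl (x : W) : leB x x := Relation.ReflTransGen.refl

theorem leB_trans {x y z : W} (h : leB x y) (h' : leB y z) : leB x z :=
  Relation.ReflTransGen.trans h h'

theorem leB_cases {x y : W} (h : leB x y) : x = y ∨ ∃ z, Covers x z ∧ leB z y :=
  Relation.ReflTransGen.cases_head h

theorem lB_le_of_leB {x y : W} (h : leB x y) : lB x ≤ lB y := by
  induction h with
  | refl => exact le_rfl
  | tail _ h ih =>
    have := Covers.lB_eq h
    omega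

theorem eq_of_leB {x y : W} (h : leB x y) (h' : lB y ≤ lB x) : x = y := by
  rcases leB_cases h with h | ⟨z, hz, h⟩
  · exact h
  · have := hz.lB_eq
    have := lB_le_of_leB h
    omega

theorem isInterval_zero {x y : W} : IsIntervalOfLength x y 0 ↔ x = y := by
  constructor
  · rintro ⟨h, h'⟩
    exact eq_of_leB h (by simp [h'])
  · rintro rfl
    exact ⟨leB_refl x, by simp⟩

theorem isInterval_succ {x y : W} {n : ℕ} :
    IsIntervalOfLength x y (n + 1) ↔ ∃ z, Covers x z ∧ IsIntervalOfLength z y n := by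
  constructor
  · rintro ⟨h, h'⟩
    rcases leB_cases h with rfl | ⟨z, hz, h⟩
    · push_cast at h'
      omega
    · refine ⟨z, hz, h, ?_⟩
      have := hz.lB_eq
      push_cast at h'
      omega
  · rintro ⟨z, hz, h, h'⟩
    refine ⟨leB_trans hz.leB h, ?_⟩
    have := hz.lB_eq
    push_cast
    omega

theorem isInterval_one {x y : W} : IsIntervalOfLength x y 1 ↔ Covers x y := by
  simp [isInterval_succ (n := 0), isInterval_zero]

theorem isInterval_two {x y : W} :
    IsIntervalOfLength x y 2 ↔ ∃ z, Covers x z ∧ Covers z y := by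
  simp [isInterval_succ (n := 1), isInterval_one]

theorem isInterval_three {x y : W} :
    IsIntervalOfLength x y 3 ↔ ∃ z z', Covers x z ∧ Covers z z' ∧ Covers z' y := by
  simp [isInterval_succ (n := 2), isInterval_two]

theorem covers_iff_of_leB {x y : W} (h : leB x y) : Covers x y ↔ lB y = lB x + 1 :=
  ⟨fun h => h.lB_eq, fun h' => isInterval_one.1 ⟨h, by simpa using h'⟩⟩

theorem interval_two {x y : W} (h : IsIntervalOfLength x y 2) :
    interval x y = {x, y} ∪ {z | Covers x z ∧ Covers z y} := by
  ext z
  constructor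
  · rintro ⟨h1, h2⟩
    have e1 := lB_le_of_leB h1
    have e2 := lB_le_of_leB h2
    have e3 : lB y = lB x + 2 := h.2
    rcases eq_or_ne (lB z) (lB x) with h3 | h3
    · exact Or.inl (Or.inl (eq_of_leB h1 h3.le).symm)
    rcases eq_or_ne (lB z) (lB y) with h4 | h4
    · exact Or.inl (Or.inr (eq_of_leB h2 h4.ge))
    · exact Or.inr ⟨(covers_iff_of_leB h1).2 (by omega), (covers_iff_of_leB h2).2 (by omega)⟩
  · rintro ((rfl | rfl) | ⟨h1, h2⟩)
    · exact ⟨leB_refl _, h.1⟩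
    · exact ⟨h.1, leB_refl _⟩
    · exact ⟨h1.leB, h2.leB⟩

theorem isSpherical_of_length_two {x y : W} (h : IsIntervalOfLength x y 2) :
    IsSpherical x y ↔ (interval x y).ncard = 4 := by
  constructor
  · intro h'
    exact h' x y (leB_refl x) (leB_refl y) h
  · intro h' a b ha hb hab
    have e1 := lB_le_of_leB ha
    have e2 := lB_le_of_leB hb
    have e3 : lB y = lB x + 2 := h.2
    have e4 : lB b = lB a + 2 := hab.2
    rw [← eq_of_leB ha (by omega), eq_of_leB hb (by omega)]
    exact h'

theorem isInterval_two_alcove {a b : ℤ} {ε : Bool} {y : W} :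
    IsIntervalOfLength (alcove a b ε) y 2 ↔ y = alcove (a + 1) b ε ∨ y = alcove a (b + 1) ε ∨
      y = alcove (a + 2) (b - 1) ε ∨ y = alcove (a - 1) (b + 2) ε := by
  rw [isInterval_two]
  cases ε
  · simp only [covers_false_iff, or_and_right, exists_or, exists_eq_left, covers_true_iff]
    have e1 : alcove (a + 1 + 1) (b - 1) false = alcove (a + 2) (b - 1) false := by congr 1; ring
    have e2 : alcove (a - 1) (b + 1 + 1) false = alcove (a - 1) (b + 2) false := by congr 1; ring
    rw [sub_add_cancel, sub_add_cancel, e1, e2]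
    tauto
  · simp only [covers_true_iff, or_and_right, exists_or, exists_eq_left, covers_false_iff]
    have e1 : alcove (a + 1 + 1) (b - 1) true = alcove (a + 2) (b - 1) true := by congr 1; ring
    have e2 : alcove (a - 1) (b + 1 + 1) true = alcove (a - 1) (b + 2) true := by congr 1; ring
    rw [add_sub_cancel_right, add_sub_cancel_right, e1, e2]
    tauto

theorem ncard_eq_three_of_ne {x y z : W} (h1 : x ≠ y) (h2 : x ≠ z) (h3 : y ≠ z) :
    ({x, y, z} : Set W).ncard = 3 :=
  Set.ncard_eq_three.2 ⟨x, y, z, h1, h2, h3, rfl⟩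

theorem ncard_eq_four_of_ne {x y z w : W} (h1 : x ≠ y) (h2 : x ≠ z) (h3 : x ≠ w) (h4 : y ≠ z)
    (h5 : y ≠ w) (h6 : z ≠ w) : ({x, y, z, w} : Set W).ncard = 4 := by
  rw [Set.ncard_insert_of_notMem (by simp [h1, h2, h3]), ncard_eq_three_of_ne h4 h5 h6]

/-- The elements `(a + 1, b, ε)` and `(a, b + 1, ε)` are reached from `(a, b, ε)` by two chains, the
other two elements at distance 2 by only one. -/
theorem isSpherical_two_alcove {a b : ℤ} {ε : Bool} {y : W}
    (h : IsIntervalOfLength (alcove a b ε) y 2) :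
    IsSpherical (alcove a b ε) y ↔ y = alcove (a + 1) b ε ∨ y = alcove a (b + 1) ε := by
  have four : ∀ z w, {z | Covers (alcove a b ε) z ∧ Covers z y} = {z, w} →
      ({alcove a b ε, y, z, w} : Set W).ncard = 4 → IsSpherical (alcove a b ε) y := by
    intro z w e e'
    rw [isSpherical_of_length_two h, interval_two h, e, Set.insert_union, Set.singleton_union, e']
  have three : ∀ z, {z | Covers (alcove a b ε) z ∧ Covers z y} = {z} →
      ({alcove a b ε, y, z} : Set W).ncard = 3 → ¬ IsSpherical (alcove a b ε) y := by
    intro z e e'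
    rw [isSpherical_of_length_two h, interval_two h, e, Set.insert_union, Set.singleton_union, e']
    decide
  rcases isInterval_two_alcove.1 h with rfl | rfl | rfl | rfl
  · refine iff_of_true ?_ (Or.inl rfl)
    cases ε
    · refine four (alcove (a + 1) (b - 1) true) (alcove a b true) ?_
        (ncard_eq_four_of_ne ?_ ?_ ?_ ?_ ?_ ?_)
      · ext z
        obtain ⟨c, d, η, rfl⟩ := alcove_surjective z
        simp only [Set.mem_ofPred_eq, covers_alcove_alcove, Set.mem_insert_iff,
          Set.mem_singleton_iff, alcove_inj]
        cases η <;> simp <;> omega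
      all_goals simp [alcove_inj]
    · refine four (alcove (a + 1) b false) (alcove a (b + 1) false) ?_
        (ncard_eq_four_of_ne ?_ ?_ ?_ ?_ ?_ ?_)
      · ext z
        obtain ⟨c, d, η, rfl⟩ := alcove_surjective z
        simp only [Set.mem_ofPred_eq, covers_alcove_alcove, Set.mem_insert_iff,
          Set.mem_singleton_iff, alcove_inj]
        cases η <;> simp <;> omega
      all_goals simp [alcove_inj]
  · refine iff_of_true ?_ (Or.inr rfl)
    cases ε
    · refine four (alcove a b true) (alcove (a - 1) (b + 1) true) ?_
        (ncard_eq_four_of_ne ?_ ?_ ?_ ?_ ?_ ?_)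
      · ext z
        obtain ⟨c, d, η, rfl⟩ := alcove_surjective z
        simp only [Set.mem_ofPred_eq, covers_alcove_alcove, Set.mem_insert_iff,
          Set.mem_singleton_iff, alcove_inj]
        cases η <;> simp <;> omega
      all_goals simp [alcove_inj]
    · refine four (alcove (a + 1) b false) (alcove a (b + 1) false) ?_
        (ncard_eq_four_of_ne ?_ ?_ ?_ ?_ ?_ ?_)
      · ext z
        obtain ⟨c, d, η, rfl⟩ := alcove_surjective z
        simp only [Set.mem_ofPred_eq, covers_alcove_alcove, Set.mem_insert_iff,
          Set.mem_singleton_iff, alcove_inj]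
        cases η <;> simp <;> omega
      all_goals simp [alcove_inj]
  · refine iff_of_false ?_ (by simp [alcove_inj])
    cases ε
    · refine three (alcove (a + 1) (b - 1) true) ?_ (ncard_eq_three_of_ne ?_ ?_ ?_)
      · ext z
        obtain ⟨c, d, η, rfl⟩ := alcove_surjective z
        simp only [Set.mem_ofPred_eq, covers_alcove_alcove, Set.mem_singleton_iff, alcove_inj]
        cases η <;> simp <;> omega
      all_goals simp [alcove_inj]
    · refine three (alcove (a + 1) b false) ?_ (ncard_eq_three_of_ne ?_ ?_ ?_)
      · ext z
        obtain ⟨c, d, η, rfl⟩ := alcove_surjective z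
        simp only [Set.mem_ofPred_eq, covers_alcove_alcove, Set.mem_singleton_iff, alcove_inj]
        cases η <;> simp <;> omega
      all_goals simp [alcove_inj]
  · refine iff_of_false ?_ (by simp [alcove_inj])
    cases ε
    · refine three (alcove (a - 1) (b + 1) true) ?_ (ncard_eq_three_of_ne ?_ ?_ ?_)
      · ext z
        obtain ⟨c, d, η, rfl⟩ := alcove_surjective z
        simp only [Set.mem_ofPred_eq, covers_alcove_alcove, Set.mem_singleton_iff, alcove_inj]
        cases η <;> simp <;> omega
      all_goals simp [alcove_inj]
    · refine three (alcove a (b + 1) false) ?_ (ncard_eq_three_of_ne ?_ ?_ ?_)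
      · ext z
        obtain ⟨c, d, η, rfl⟩ := alcove_surjective z
        simp only [Set.mem_ofPred_eq, covers_alcove_alcove, Set.mem_singleton_iff, alcove_inj]
        cases η <;> simp <;> omega
      all_goals simp [alcove_inj]

/-- An element at distance 3 other than `(a + 1, b + 1, 0)` above `(a, b, 1)` lies above
`(a + 2, b - 1, ε)` or `(a - 1, b + 2, ε)`, which are tops of intervals with three elements. -/
theorem isSpherical_three_alcove {a b : ℤ} {ε : Bool} {y : W}
    (h : IsIntervalOfLength (alcove a b ε) y 3) :
    IsSpherical (alcove a b ε) y ↔ ε = true ∧ y = alcove (a + 1) (b + 1) false := by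
  obtain ⟨z, z', h1, h2, h3⟩ := isInterval_three.1 h
  have e : lB y = lB (alcove a b ε) + 3 := h.2
  constructor
  · intro hs
    have key : ∀ w, Covers w y → IsIntervalOfLength (alcove a b ε) w 2 →
        w = alcove (a + 1) b ε ∨ w = alcove a (b + 1) ε := by
      intro w hw hw'
      rw [← isSpherical_two_alcove hw']
      exact fun c d hc hd => hs c d hc (leB_trans hd hw.leB)
    have hz := key z' h3 (isInterval_two.2 ⟨z, h1, h2⟩)
    have k1 := fun h => key (alcove (a + 2) (b - 1) ε) h (isInterval_two_alcove.2 (by simp))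
    have k2 := fun h => key (alcove (a - 1) (b + 2) ε) h (isInterval_two_alcove.2 (by simp))
    cases ε
    · exfalso
      simp only [covers_false_iff, alcove_inj] at k1 k2
      rcases hz with rfl | rfl <;> rw [covers_false_iff] at h3 <;>
        rcases h3 with rfl | rfl | rfl <;> simp only [alcove_inj] at k1 k2 <;>
        simp at k1 k2 <;> omega
    · simp only [covers_true_iff, alcove_inj] at k1 k2
      rcases hz with rfl | rfl <;> rw [covers_true_iff] at h3 <;> rcases h3 with rfl | rfl <;>
        simp only [alcove_inj] at k1 k2 ⊢ <;> simp at k1 k2 ⊢ <;> omega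
  · rintro ⟨rfl, rfl⟩ c d hc hd hcd
    have e1 := lB_le_of_leB hc
    have e2 := lB_le_of_leB hd
    have e3 : lB d = lB c + 2 := hcd.2
    rw [← isSpherical_of_length_two hcd]
    rcases eq_or_ne (lB c) (lB (alcove a b true)) with h4 | h4
    · obtain rfl := eq_of_leB hc h4.le
      rw [isSpherical_two_alcove hcd]
      have hd' : Covers d (alcove (a + 1) (b + 1) false) := (covers_iff_of_leB hd).2 (by omega)
      rcases isInterval_two_alcove.1 hcd with rfl | rfl | rfl | rfl
      · exact Or.inl rfl
      · exact Or.inr rfl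
      all_goals
        rw [covers_true_iff] at hd'
        simp only [alcove_inj] at hd'
        omega
    · obtain rfl := eq_of_leB hd (by omega)
      have hc' : Covers (alcove a b true) c := (covers_iff_of_leB hc).2 (by omega)
      rcases covers_true_iff.1 hc' with rfl | rfl
      · rw [isSpherical_two_alcove hcd]
        exact Or.inr rfl
      · rw [isSpherical_two_alcove hcd]
        exact Or.inl rfl

theorem isInterval_three_alcove (a b : ℤ) :
    IsIntervalOfLength (alcove a b true) (alcove (a + 1) (b + 1) false) 3 := by
  refine isInterval_three.2 ⟨alcove (a + 1) b false, alcove (a + 1) b true, ?_, ?_, ?_⟩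
  · simp [covers_true_iff]
  · simp [covers_false_iff]
  · simp [covers_true_iff]

theorem not_isSpherical_of_three_lt {x y : W} {n : ℕ} (hn : 3 < n)
    (h : IsIntervalOfLength x y n) : ¬ IsSpherical x y := by
  obtain ⟨n, rfl⟩ : ∃ m, n = m + 4 := ⟨n - 4, by omega⟩
  intro hs
  obtain ⟨x₁, h1, h⟩ := isInterval_succ.1 h
  obtain ⟨x₂, h2, h⟩ := isInterval_succ.1 h
  obtain ⟨x₃, h3, h⟩ := isInterval_succ.1 h
  obtain ⟨x₄, h4, h⟩ := isInterval_succ.1 h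
  have s1 : IsSpherical x x₃ := fun a b ha hb =>
    hs a b ha (leB_trans hb (leB_trans h4.leB h.1))
  have s2 : IsSpherical x₁ x₄ := fun a b ha hb =>
    hs a b (leB_trans h1.leB ha) (leB_trans hb h.1)
  obtain ⟨a, b, ε, rfl⟩ := alcove_surjective x
  obtain ⟨a', b', ε', rfl⟩ := alcove_surjective x₁
  -- Both `x` and `x₁` are bottoms of spherical intervals of length 3, so both have odd `l_B`.
  obtain ⟨rfl, -⟩ := (isSpherical_three_alcove (isInterval_three.2 ⟨_, _, h1, h2, h3⟩)).1 s1
  obtain ⟨rfl, -⟩ := (isSpherical_three_alcove (isInterval_three.2 ⟨_, _, h2, h3, h4⟩)).1 s2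
  have := h1.lB_eq
  simp only [lB_alcove, cond_true] at this
  omega

/-! ### Automorphisms of the alcove order -/

/-- Translation of the alcove coordinates by an arbitrary integral vector. Unless `p - q` is
divisible by 3, this is not right multiplication by an element of `T`. -/
def shift (p q : ℤ) : W ≃ W :=
  coords.symm.trans (((Equiv.addRight p).prodCongr ((Equiv.addRight q).prodCongr
    (Equiv.refl Bool))).trans coords)

theorem shift_alcove (p q a b : ℤ) (ε : Bool) :
    shift p q (alcove a b ε) = alcove (a + p) (b + q) ε := by
  have h : coords.symm (alcove a b ε) = (a, b, ε) := coords.symm_apply_eq.2 rfl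
  simp only [shift, Equiv.trans_apply, h]
  rfl

theorem Covers.shift (p q : ℤ) {x y : W} (h : Covers x y) :
    Covers (shift p q x) (shift p q y) := by
  obtain ⟨a, b, ε, rfl⟩ := alcove_surjective x
  rw [shift_alcove]
  cases ε
  · rw [covers_false_iff] at h ⊢
    rcases h with rfl | rfl | rfl <;> simp only [shift_alcove, alcove_inj] <;> simp <;> omega
  · rw [covers_true_iff] at h ⊢
    rcases h with rfl | rfl <;> simp only [shift_alcove, alcove_inj] <;> simp <;> omega

theorem shift_symm_apply (p q : ℤ) (x : W) : shift (-p) (-q) (shift p q x) = x := by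
  obtain ⟨a, b, ε, rfl⟩ := alcove_surjective x
  simp [shift_alcove]

/-- Translation of the alcove coordinates, as an automorphism of the alcove order. -/
def shiftIso (p q : ℤ) : leB ≃r leB where
  toEquiv := shift p q
  map_rel_iff' {x y} := by
    have key : ∀ p q x y, leB x y → leB (shift p q x) (shift p q y) := fun p q x y h =>
      Relation.ReflTransGen.lift (shift p q) (fun _ _ h => Covers.shift p q h) _ _ h
    refine ⟨fun h => ?_, key p q x y⟩
    have := key (-p) (-q) _ _ h
    rwa [shift_symm_apply, shift_symm_apply] at this

theorem exists_automorphism {x y : W} (h : lB x ≡ lB y [ZMOD 2]) :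
    ∃ γ : leB ≃r leB, γ x = y := by
  obtain ⟨a, b, ε, rfl⟩ := alcove_surjective x
  obtain ⟨a', b', ε', rfl⟩ := alcove_surjective y
  obtain rfl : ε = ε' := by
    rw [lB_alcove, lB_alcove, Int.ModEq] at h
    cases ε <;> cases ε' <;> simp only [cond_true, cond_false] at h <;> first | rfl | omega
  refine ⟨shiftIso (a' - a) (b' - b), ?_⟩
  change shift _ _ _ = _
  rw [shift_alcove, alcove_inj]
  simp


/-! ### Translations and cosets -/

theorem letter_injective {k l : ℤ} (h : letter k = letter l) : (k - l) % 3 = 0 := by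
  have e := congrArg (fun w => w * alcove 0 0 false) h
  simp only [letter_mul_alcove] at e
  split_ifs at e <;> simp [alcove_inj] at e <;> omega

/-- The coset of `T` containing an element is given by its finite part. -/
theorem alcove_mem_smul_T {a b : ℤ} {ε : Bool} {g : FinW} :
    alcove a b ε ∈ g.toW • (T : Set W) ↔ finPart (a - b) ε = g := by
  have key : ∀ x : W, x ∈ T ↔ ∃ m n : ℤ, x = ⟨_, translation_mem m n⟩ := by
    intro x
    rw [T, Subgroup.mem_subgroupOf, closure_translation]
    constructor
    · rintro ⟨y, hy⟩
      exact ⟨y.toAdd.1, y.toAdd.2, Subtype.ext hy.symm⟩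
    · rintro ⟨m, n, rfl⟩
      exact ⟨.ofAdd (m, n), rfl⟩
  constructor
  · rintro ⟨t, ht, h⟩
    obtain ⟨m, n, rfl⟩ := (key t).1 ht
    change elt g m n = alcove a b ε at h
    exact (elt_inj.1 h).1.symm
  · rintro rfl
    exact ⟨_, (key _).2 ⟨_, _, rfl⟩, rfl⟩

theorem finPart_eq_aba {j : ℤ} {ε : Bool} : finPart j ε = .aba ↔ ε = true ∧ j % 3 = 0 := by
  unfold finPart; split_ifs <;> simp_all

theorem finPart_eq_b {j : ℤ} {ε : Bool} : finPart j ε = .b ↔ ε = true ∧ j % 3 = 1 := by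
  unfold finPart; split_ifs <;> simp_all <;> omega

theorem finPart_eq_a {j : ℤ} {ε : Bool} : finPart j ε = .a ↔ ε = true ∧ j % 3 = 2 := by
  unfold finPart; split_ifs <;> simp_all <;> omega

theorem letters_mul_alcove_left (a b : ℤ) :
    letter (a - b - 1) * letter (a - b) * letter (a - b - 1) * alcove a b true =
      alcove (a + 1) (b + 1) false := by
  rw [mul_assoc, mul_assoc, letter_mul_alcove_true_two (by omega),
    letter_mul_alcove_false_one (by omega), letter_mul_alcove_true_zero (by omega)]

theorem letters_mul_alcove_right (a b : ℤ) :
    letter (a - b) * letter (a - b - 1) * letter (a - b) * alcove a b true =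
      alcove (a + 1) (b + 1) false := by
  rw [mul_assoc, mul_assoc, letter_mul_alcove_true_zero (by omega),
    letter_mul_alcove_false_one (by omega), letter_mul_alcove_true_two (by omega)]

theorem mem_aba_smul_T {x : W} : x ∈ (sα * sβ * sα) • (T : Set W) ↔
    ∃ a b, (a - b) % 3 = 0 ∧ x = alcove a b true ∧
      sα * sβ * sα * x = alcove (a + 1) (b + 1) false := by
  obtain ⟨a, b, ε, rfl⟩ := alcove_surjective x
  rw [show sα * sβ * sα = FinW.toW .aba from rfl, alcove_mem_smul_T, finPart_eq_aba]
  constructor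
  · rintro ⟨rfl, h⟩
    refine ⟨a, b, h, rfl, ?_⟩
    rw [← letters_mul_alcove_left, letter_two (by omega : (a - b - 1) % 3 = 2), letter_zero h]
    rfl
  · rintro ⟨a', b', h, h', -⟩
    obtain ⟨rfl, rfl, rfl⟩ := alcove_inj.1 h'
    exact ⟨rfl, h⟩

theorem mem_b_smul_T {x : W} : x ∈ sβ • (T : Set W) ↔
    ∃ a b, (a - b) % 3 = 1 ∧ x = alcove a b true ∧
      s₀ * sβ * s₀ * x = alcove (a + 1) (b + 1) false := by
  obtain ⟨a, b, ε, rfl⟩ := alcove_surjective x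
  rw [show sβ = FinW.toW .b from rfl, alcove_mem_smul_T, finPart_eq_b]
  constructor
  · rintro ⟨rfl, h⟩
    refine ⟨a, b, h, rfl, ?_⟩
    rw [← letters_mul_alcove_right, letter_zero (by omega : (a - b - 1) % 3 = 0), letter_one h]
    rfl
  · rintro ⟨a', b', h, h', -⟩
    obtain ⟨rfl, rfl, rfl⟩ := alcove_inj.1 h'
    exact ⟨rfl, h⟩

theorem mem_a_smul_T {x : W} : x ∈ sα • (T : Set W) ↔
    ∃ a b, (a - b) % 3 = 2 ∧ x = alcove a b true ∧
      sα * s₀ * sα * x = alcove (a + 1) (b + 1) false := by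
  obtain ⟨a, b, ε, rfl⟩ := alcove_surjective x
  rw [show sα • (T : Set W) = FinW.toW .a • (T : Set W) from rfl, alcove_mem_smul_T, finPart_eq_a]
  constructor
  · rintro ⟨rfl, h⟩
    refine ⟨a, b, h, rfl, ?_⟩
    rw [← letters_mul_alcove_right, letter_one (by omega : (a - b - 1) % 3 = 1), letter_two h]
  · rintro ⟨a', b', h, h', -⟩
    obtain ⟨rfl, rfl, rfl⟩ := alcove_inj.1 h'
    exact ⟨rfl, h⟩

/-- Two successive wall crossings never lead to `(a + 2, b - 1, ε)` or `(a - 1, b + 2, ε)`. -/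
theorem exists_simple_iff {a b : ℤ} {ε : Bool} {y : W}
    (h : IsIntervalOfLength (alcove a b ε) y 2) :
    (∃ r₁ ∈ S, ∃ r₂ ∈ S, r₁ ≠ r₂ ∧ y = r₁ * r₂ * alcove a b ε) ↔
      y = alcove (a + 1) b ε ∨ y = alcove a (b + 1) ε := by
  constructor
  · rintro ⟨r₁, h₁, r₂, h₂, -, rfl⟩
    obtain ⟨k, rfl⟩ := mem_S_iff.1 h₁
    obtain ⟨l, rfl⟩ := mem_S_iff.1 h₂
    have h' := isInterval_two_alcove.1 h
    rw [mul_assoc] at h' ⊢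
    have key : ∃ a' b', letter k * (letter l * alcove a b ε) = alcove a' b' ε ∧
        ¬ (a' = a + 2 ∧ b' = b - 1) ∧ ¬ (a' = a - 1 ∧ b' = b + 2) := by
      rw [letter_mul_alcove a b l]
      cases ε <;> split_ifs <;>
      simp only [cond_true, cond_false, Bool.not_true, Bool.not_false] <;>
      rw [letter_mul_alcove] <;> split_ifs <;> refine ⟨_, _, rfl, ?_⟩ <;> omega
    obtain ⟨a', b', e, n1, n2⟩ := key
    rw [e] at h' ⊢
    simp only [alcove_inj, and_true] at h' ⊢
    tauto
  · have key : ∀ k l, (k - l) % 3 ≠ 0 → y = letter k * (letter l * alcove a b ε) →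
        ∃ r₁ ∈ S, ∃ r₂ ∈ S, r₁ ≠ r₂ ∧ y = r₁ * r₂ * alcove a b ε := by
      intro k l h h'
      exact ⟨_, letter_mem_S k, _, letter_mem_S l, fun e => h (letter_injective e),
        by rw [h', mul_assoc]⟩
    cases ε <;> rintro (rfl | rfl)
    · refine key (a - b) (a - b + 1) (by omega) ?_
      rw [letter_mul_alcove_false_one (by omega), letter_mul_alcove_true_zero (by omega)]
    · refine key (a - b - 1) (a - b + 1) (by omega) ?_
      rw [letter_mul_alcove_false_one (by omega), letter_mul_alcove_true_two (by omega)]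
    · refine key (a - b + 2) (a - b) (by omega) ?_
      rw [letter_mul_alcove_true_zero (by omega), letter_mul_alcove_false_one (by omega)]
    · refine key (a - b) (a - b - 1) (by omega) ?_
      rw [letter_mul_alcove_true_two (by omega), letter_mul_alcove_false_one (by omega)]

/-- The roots of the finite root system in the coordinates given by `α` and `β`. -/
def intRoots : Finset (ℤ × ℤ) := {(1, 0), (0, 1), (1, 1), (-1, 0), (0, -1), (-1, -1)}

theorem act_mem_intRoots (g : FinW) : ∀ p ∈ intRoots, g.act p ∈ intRoots := by
  cases g <;> decide

theorem exists_act_eq (g : FinW) : ∀ p ∈ intRoots, ∃ q ∈ intRoots, g.act q = p := by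
  cases g <;> decide

/-- The products `s_{δ-γ} s_γ` are the translations by the roots of the finite root system. -/
theorem s_mul_s_eq_translation {t : V' ≃ₗ[ℝ] V'} :
    (∃ γ ∈ ({α, β, α + β, δ - α, δ - β, δ - α - β} : Set V'), t = s (δ - γ) * s γ) ↔
      ∃ p ∈ intRoots, t = translation ((p.1 : ℝ), (p.2 : ℝ)) := by
  have h1 : s (δ - α) = s ((1, 0), -1) := by rw [← s_neg]; congr 1; ext <;> simp [δ, α]
  have h2 : s (δ - β) = s ((0, 1), -1) := by rw [← s_neg]; congr 1; ext <;> simp [δ, β]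
  have h3 : s (δ - (α + β)) = s ((1, 1), -1) := by
    rw [← s_neg]; congr 1; ext <;> simp [δ, α, β]
  have h3' : s (δ - α - β) = s ((1, 1), -1) := by rw [← h3]; congr 1; abel
  have h4 : s (α + β) = s ((1, 1), 0) := by congr 1; ext <;> simp [α, β]
  have h5 : s (δ - (δ - α)) = s ((1, 0), 0) := by rw [sub_sub_cancel]; rfl
  have h6 : s (δ - (δ - β)) = s ((0, 1), 0) := by rw [sub_sub_cancel]; rfl
  have h7 : s (δ - (δ - α - β)) = s ((1, 1), 0) := by rw [← h4]; congr 1; abel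
  have h8 : s α = s ((1, 0), 0) := rfl
  have h9 : s β = s ((0, 1), 0) := rfl
  simp only [intRoots, Set.mem_insert_iff, Set.mem_singleton_iff, Finset.mem_insert,
    Finset.mem_singleton, or_and_right, exists_or, exists_eq_left, h1, h2, h3, h3', h4, h5, h6, h7,
    h8, h9]
  have e1 : s ((1, 0), -1) * s ((1, 0), 0) = translation (((-1 : ℤ) : ℝ), ((0 : ℤ) : ℝ)) := by
    refine LinearEquiv.ext fun ⟨⟨x, y⟩, z⟩ => ?_
    simp only [LinearEquiv.mul_apply, s_α_apply, translation_apply]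
    ext <;> simp; ring
  have e2 : s ((0, 1), -1) * s ((0, 1), 0) = translation (((0 : ℤ) : ℝ), ((-1 : ℤ) : ℝ)) := by
    refine LinearEquiv.ext fun ⟨⟨x, y⟩, z⟩ => ?_
    simp only [LinearEquiv.mul_apply, s_β_apply, translation_apply]
    ext <;> simp; ring
  have e3 : s ((1, 1), -1) * s ((1, 1), 0) = translation (((-1 : ℤ) : ℝ), ((-1 : ℤ) : ℝ)) := by
    refine LinearEquiv.ext fun ⟨⟨x, y⟩, z⟩ => ?_
    simp only [LinearEquiv.mul_apply, s_θ_apply, translation_apply]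
    ext <;> simp; ring
  have e4 : s ((1, 0), 0) * s ((1, 0), -1) = translation (((1 : ℤ) : ℝ), ((0 : ℤ) : ℝ)) := by
    refine LinearEquiv.ext fun ⟨⟨x, y⟩, z⟩ => ?_
    simp only [LinearEquiv.mul_apply, s_α_apply, translation_apply]
    ext <;> simp; ring
  have e5 : s ((0, 1), 0) * s ((0, 1), -1) = translation (((0 : ℤ) : ℝ), ((1 : ℤ) : ℝ)) := by
    refine LinearEquiv.ext fun ⟨⟨x, y⟩, z⟩ => ?_
    simp only [LinearEquiv.mul_apply, s_β_apply, translation_apply]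
    ext <;> simp; ring
  have e6 : s ((1, 1), 0) * s ((1, 1), -1) = translation (((1 : ℤ) : ℝ), ((1 : ℤ) : ℝ)) := by
    refine LinearEquiv.ext fun ⟨⟨x, y⟩, z⟩ => ?_
    simp only [LinearEquiv.mul_apply, s_θ_apply, translation_apply]
    ext <;> simp; ring
  rw [e1, e2, e3, e4, e5, e6]
  tauto

theorem exists_translation_iff {a b : ℤ} {ε : Bool} {y : W} :
    (∃ γ ∈ ({α, β, α + β, δ - α, δ - β, δ - α - β} : Set V'),
      (y : V' ≃ₗ[ℝ] V') = s (δ - γ) * s γ * (alcove a b ε : W)) ↔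
    ∃ p ∈ intRoots, y = alcove (a + 2 * p.1 - p.2) (b + 2 * p.2 - p.1) ε := by
  have h1 : (∃ γ ∈ ({α, β, α + β, δ - α, δ - β, δ - α - β} : Set V'),
      (y : V' ≃ₗ[ℝ] V') = s (δ - γ) * s γ * (alcove a b ε : W)) ↔
      ∃ p ∈ intRoots, (y : V' ≃ₗ[ℝ] V') =
        translation ((p.1 : ℝ), (p.2 : ℝ)) * (alcove a b ε : W) := by
    have e : ∀ t, (y : V' ≃ₗ[ℝ] V') = t * (alcove a b ε : W) ↔
        (y : V' ≃ₗ[ℝ] V') * (alcove a b ε : V' ≃ₗ[ℝ] V')⁻¹ = t :=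
      fun t => mul_inv_eq_iff_eq_mul.symm
    simp only [e]
    exact s_mul_s_eq_translation
  rw [h1]
  obtain ⟨g, m, n, rfl, rfl, rfl⟩ := exists_elt_coords a b ε
  rw [← elt_eq_alcove]
  have h2 : ∀ p q : ℤ, (y : V' ≃ₗ[ℝ] V') = translation ((p : ℝ), (q : ℝ)) * (elt g m n : W) ↔
      y = elt g (m + (g.inv.act (p, q)).1) (n + (g.inv.act (p, q)).2) := by
    intro p q
    rw [translation_mul_elt]
    exact Subtype.coe_inj
  simp only [h2]
  have h3 : ∀ p q : ℤ,
      alcove (2 * m - n - g.negα + 2 * p - q) (2 * n - m - g.negβ + 2 * q - p) g.odd =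
        elt g (m + p) (n + q) := by
    intro p q
    rw [elt_eq_alcove]
    congr 1 <;> ring
  simp only [h3]
  constructor
  · rintro ⟨p, hp, rfl⟩
    exact ⟨_, act_mem_intRoots g.inv p hp, rfl⟩
  · rintro ⟨p, hp, rfl⟩
    obtain ⟨q, hq, rfl⟩ := exists_act_eq g.inv p hp
    exact ⟨q, hq, rfl⟩

/-- Of the six translations by roots only those by `α` and `β`, acting on the right, raise `l_B` by
two. -/
theorem exists_reflections_iff {a b : ℤ} {ε : Bool} {y : W}
    (h : IsIntervalOfLength (alcove a b ε) y 2) :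
    (∃ γ ∈ ({α, β, α + β, δ - α, δ - β, δ - α - β} : Set V'),
      (y : V' ≃ₗ[ℝ] V') = s (δ - γ) * s γ * (alcove a b ε : W)) ↔
      y = alcove (a + 2) (b - 1) ε ∨ y = alcove (a - 1) (b + 2) ε := by
  rw [exists_translation_iff]
  constructor
  · rintro ⟨p, hp, rfl⟩
    have h2 := h.2
    simp only [lB_alcove] at h2
    simp only [intRoots, Finset.mem_insert, Finset.mem_singleton] at hp
    rcases hp with rfl | rfl | rfl | rfl | rfl | rfl <;> simp [alcove_inj] at h2 ⊢ <;> omega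
  · rintro (rfl | rfl)
    · exact ⟨(1, 0), by decide, by congr 1 <;> ring⟩
    · exact ⟨(0, 1), by decide, by congr 1 <;> ring⟩

/-! ### The two infinite words and their prefixes -/

theorem letter_mul_self (k : ℤ) : letter k * letter k = 1 := by
  apply Subtype.ext
  rcases letter_mem_S k with h | h | h <;> rw [h] <;> exact s_mul_self _

theorem letter_inv (k : ℤ) : (letter k)⁻¹ = letter k :=
  inv_eq_of_mul_eq_one_left (letter_mul_self k)

/-- The `i`-th alcove of the strip `a + b + ε = 0`, numbered by `i = a - b`; thus `a = ⌊i / 2⌋` and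
`b = -⌈i / 2⌉`. -/
def strip (i : ℤ) : W := alcove (i / 2) (-((i + 1) / 2)) (decide (i % 2 = 1))

theorem letter_mul_strip (i : ℤ) : letter i * strip i = strip (i + 1) := by
  unfold strip
  rcases Int.emod_two_eq_zero_or_one i with h | h
  · rw [decide_eq_false (by omega), letter_mul_alcove_false_zero (by omega),
      decide_eq_true (by omega), alcove_inj]
    exact ⟨by omega, by omega, rfl⟩
  · rw [decide_eq_true (by omega), letter_mul_alcove_true_zero (by omega),
      decide_eq_false (by omega), alcove_inj]
    exact ⟨by omega, by omega, rfl⟩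

theorem letter_pred_mul_strip (i : ℤ) : letter (i - 1) * strip i = strip (i - 1) := by
  have h := letter_mul_strip (i - 1)
  rw [sub_add_cancel] at h
  rw [← h, ← mul_assoc, letter_mul_self, one_mul]

theorem partialProd_succ (r : ℕ → W) (n : ℕ) :
    partialProd r (n + 1) = partialProd r n * r n := by
  simp [partialProd, List.range_succ]

theorem strip_zero : strip 0 = 1 := by
  rw [← alcove_one]
  simp [strip]

theorem xWord_eq (n : ℕ) : xWord n = letter n := by
  unfold xWord periodicWord letter
  congr 1
  · simp; omega
  · congr 1
    simp; omega

theorem yWord_eq (n : ℕ) : yWord n = letter (-(n : ℤ) - 1) := by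
  unfold yWord periodicWord letter
  split_ifs <;> first | rfl | omega

theorem partialProd_xWord_inv (n : ℕ) : (partialProd xWord n)⁻¹ = strip n := by
  induction n with
  | zero => simp [partialProd, strip_zero]
  | succ n ih =>
    rw [partialProd_succ, mul_inv_rev, ih, xWord_eq, letter_inv, letter_mul_strip]
    rfl

theorem partialProd_yWord_inv (n : ℕ) : (partialProd yWord n)⁻¹ = strip (-(n : ℤ)) := by
  induction n with
  | zero => simp [partialProd, strip_zero]
  | succ n ih =>
    rw [partialProd_succ, mul_inv_rev, ih, yWord_eq, letter_inv, letter_pred_mul_strip]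
    congr 1
    push_cast
    ring

theorem pre_neg (n : ℕ) : pre (-(n : ℤ)) = partialProd yWord n := by
  cases n with
  | zero => rfl
  | succ n => rfl

theorem pre_inv (i : ℤ) : (pre i)⁻¹ = strip i := by
  obtain ⟨n, rfl | rfl⟩ := Int.eq_nat_or_neg i
  · exact partialProd_xWord_inv n
  · rw [pre_neg, partialProd_yWord_inv]

theorem length_strip (i : ℤ) : length (strip i) = i.natAbs := by
  rw [strip, length_alcove]
  unfold hyperplaneCount
  rcases Int.emod_two_eq_zero_or_one i with h | h
  · rw [decide_eq_false (by omega), cond_false]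
    omega
  · rw [decide_eq_true (by omega), cond_true]
    omega

theorem length_pre (i : ℤ) : length (pre i) = i.natAbs := by
  rw [← length_inv, pre_inv, length_strip]

theorem isInfiniteReducedWord_xWord : IsInfiniteReducedWord xWord :=
  ⟨fun n => by rw [xWord_eq]; exact letter_mem_S _, fun n => (length_pre n).trans (by simp)⟩

theorem isInfiniteReducedWord_yWord : IsInfiniteReducedWord yWord :=
  ⟨fun n => by rw [yWord_eq]; exact letter_mem_S _, fun n => by
    rw [← pre_neg, length_pre]; simp⟩

theorem mem_N {γ : V} (hγ : γ ∈ finPos) {g : W} {a b : ℤ} {ε : Bool} (h : g⁻¹ = alcove a b ε)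
    (k : ℤ) : ((γ, (k : ℝ)) : V') ∈ N g ↔ 0 ≤ k ∧ k + crossing a b ε γ < 0 := by
  rw [N, Set.mem_ofPred_eq, h, mem_posRoots_of_finPos hγ, alcove_apply_mem_negRoots hγ]

theorem neg_mem_N {γ : V} (hγ : γ ∈ finPos) {g : W} {a b : ℤ} {ε : Bool} (h : g⁻¹ = alcove a b ε)
    (k : ℤ) : ((-γ, (k : ℝ)) : V') ∈ N g ↔ 1 ≤ k ∧ k ≤ crossing a b ε γ := by
  rw [N, Set.mem_ofPred_eq, h, mem_posRoots_neg_of_finPos hγ, alcove_apply_neg_mem_negRoots hγ]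

/-- If `d_γ` has constant sign along an infinite word, it has that sign for every prefix: otherwise
`γ` or `-γ + δ` would be an inversion of the prefix but not of the word. -/
theorem crossing_sign_of_isPrefix {r : ℕ → W} {f : ℕ → ℤ}
    (hr : ∀ n, (partialProd r n)⁻¹ = strip (f n)) {g : W} {a b : ℤ} {ε : Bool}
    (h : g⁻¹ = alcove a b ε) (hg : IsPrefix g r) {γ : V} (hγ : γ ∈ finPos) :
    ((∀ n, 0 ≤ crossing (f n / 2) (-((f n + 1) / 2)) (decide (f n % 2 = 1)) γ) →
      0 ≤ crossing a b ε γ) ∧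
    ((∀ n, crossing (f n / 2) (-((f n + 1) / 2)) (decide (f n % 2 = 1)) γ ≤ 0) →
      crossing a b ε γ ≤ 0) := by
  constructor
  · intro hf
    by_contra hlt
    have h1 : ((γ, ((0 : ℤ) : ℝ)) : V') ∈ N g := (mem_N hγ h 0).2 ⟨le_rfl, by omega⟩
    obtain ⟨n, hn⟩ := Set.mem_iUnion.1 (hg h1)
    have := ((mem_N hγ (hr n) 0).1 hn).2
    have := hf n
    omega
  · intro hf
    by_contra hlt
    have h1 : ((-γ, ((1 : ℤ) : ℝ)) : V') ∈ N g := (neg_mem_N hγ h 1).2 ⟨le_rfl, by omega⟩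
    obtain ⟨n, hn⟩ := Set.mem_iUnion.1 (hg h1)
    have := ((neg_mem_N hγ (hr n) 1).1 hn).2
    have := hf n
    omega

/-- The alcoves of the strip are not separated from the fundamental one by any hyperplane of
direction `α + β`. -/
theorem crossing_strip_θ (i : ℤ) :
    crossing (i / 2) (-((i + 1) / 2)) (decide (i % 2 = 1)) (1, 1) = 0 := by
  rw [crossing_θ]
  rcases Int.emod_two_eq_zero_or_one i with h | h
  · rw [decide_eq_false (by omega), cond_false]
    omega
  · rw [decide_eq_true (by omega), cond_true]
    omega

theorem eq_strip {a b i : ℤ} {ε : Bool} (h : (a + b + bif ε then 1 else 0) = 0) (h' : a - b = i) :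
    alcove a b ε = strip i := by
  rw [strip, alcove_inj]
  cases ε <;> simp only [cond_true, cond_false] at h
  · exact ⟨by omega, by omega, (decide_eq_false (by omega)).symm⟩
  · exact ⟨by omega, by omega, (decide_eq_true (by omega)).symm⟩

theorem isPrefix_xWord_iff (i : ℕ) (g : W) :
    (IsPrefix g xWord ∧ length g = i) ↔ g = pre i := by
  constructor
  · rintro ⟨hg, hl⟩
    obtain ⟨a, b, ε, h⟩ := alcove_surjective g⁻¹
    have key := fun γ => crossing_sign_of_isPrefix partialProd_xWord_inv h hg (γ := γ)
    have hα := (key (1, 0) (by simp [finPos])).1 fun n => by rw [crossing_α]; omega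
    have hβ := (key (0, 1) (by simp [finPos])).2 fun n => by rw [crossing_β]; omega
    have hθ := (key (1, 1) (by simp [finPos])).1 fun n => (crossing_strip_θ n).ge
    have hθ' := (key (1, 1) (by simp [finPos])).2 fun n => (crossing_strip_θ n).le
    rw [crossing_α] at hα
    rw [crossing_β] at hβ
    rw [crossing_θ] at hθ hθ'
    rw [← length_inv, h, length_alcove] at hl
    unfold hyperplaneCount at hl
    rw [← inv_inj, h, pre_inv]
    exact eq_strip (by omega) (by omega)
  · rintro rfl
    exact ⟨Set.subset_iUnion (fun n => N (partialProd xWord n)) i, length_pre i⟩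

theorem isPrefix_yWord_iff (i : ℕ) (g : W) :
    (IsPrefix g yWord ∧ length g = i) ↔ g = pre (-(i : ℤ)) := by
  constructor
  · rintro ⟨hg, hl⟩
    obtain ⟨a, b, ε, h⟩ := alcove_surjective g⁻¹
    have key := fun γ => crossing_sign_of_isPrefix partialProd_yWord_inv h hg (γ := γ)
    have hα := (key (1, 0) (by simp [finPos])).2 fun n => by rw [crossing_α]; omega
    have hβ := (key (0, 1) (by simp [finPos])).1 fun n => by rw [crossing_β]; omega
    have hθ := (key (1, 1) (by simp [finPos])).1 fun n => (crossing_strip_θ _).ge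
    have hθ' := (key (1, 1) (by simp [finPos])).2 fun n => (crossing_strip_θ _).le
    rw [crossing_α] at hα
    rw [crossing_β] at hβ
    rw [crossing_θ] at hθ hθ'
    rw [← length_inv, h, length_alcove] at hl
    unfold hyperplaneCount at hl
    rw [← inv_inj, h, pre_inv]
    exact eq_strip (by omega) (by omega)
  · rintro rfl
    refine ⟨?_, by rw [length_pre]; simp⟩
    rw [pre_neg]
    exact Set.subset_iUnion (fun n => N (partialProd yWord n)) i

/-! ### The infinite dihedral subgroup -/

theorem alcove_mul_uv (a b : ℤ) (ε : Bool) : alcove a b ε * (u * v) = alcove (a + 1) (b + 1) ε := by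
  rw [← mul_assoc, alcove_mul_u, alcove_mul_v, Bool.not_not]
  congr 1 <;> ring

theorem alcove_mul_uv_zpow (a b k : ℤ) (ε : Bool) :
    alcove a b ε * (u * v) ^ k = alcove (a + k) (b + k) ε := by
  induction k with
  | zero => simp
  | succ k ih => rw [zpow_add_one, ← mul_assoc, ih, alcove_mul_uv, add_assoc, add_assoc]
  | pred k ih =>
    rw [zpow_sub_one, ← mul_assoc, ih, mul_inv_eq_iff_eq_mul, alcove_mul_uv]
    congr 1 <;> ring

theorem vu_eq : v * u = (u * v)⁻¹ := by
  have hu : u⁻¹ = u := by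
    apply inv_eq_of_mul_eq_one_left
    apply Subtype.ext
    rw [Subgroup.coe_mul, u_coe]
    exact s_mul_self _
  have hv : v⁻¹ = v := letter_inv 1
  rw [mul_inv_rev, hu, hv]

theorem alcove_mul_vu_zpow (a b k : ℤ) (ε : Bool) :
    alcove a b ε * (v * u) ^ k = alcove (a - k) (b - k) ε := by
  rw [vu_eq, inv_zpow', alcove_mul_uv_zpow]
  rfl

/-- The identification of `ZMod 0` with `ℤ`. -/
def zmodZero : ZMod 0 ≃+ ℤ := AddEquiv.refl ℤ

/-- The map sending `r i` to `(u v) ^ i` and `sr i` to `u (u v) ^ i`. -/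
def dihedralFun : DihedralGroup 0 → W
  | .r i => (u * v) ^ zmodZero i
  | .sr i => u * (u * v) ^ zmodZero i

theorem alcove_mul_dihedralFun_r (a b : ℤ) (i : ZMod 0) (ε : Bool) :
    alcove a b ε * dihedralFun (.r i) = alcove (a + zmodZero i) (b + zmodZero i) ε :=
  alcove_mul_uv_zpow a b _ ε

theorem alcove_mul_dihedralFun_sr (a b : ℤ) (i : ZMod 0) (ε : Bool) :
    alcove a b ε * dihedralFun (.sr i) = alcove (-b - 1 + zmodZero i) (-a - 1 + zmodZero i) !ε := by
  rw [dihedralFun, ← mul_assoc, alcove_mul_u, alcove_mul_uv_zpow]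

theorem dihedralFun_mul (x y : DihedralGroup 0) :
    dihedralFun (x * y) = dihedralFun x * dihedralFun y := by
  apply mul_left_cancel (a := alcove 0 0 false)
  rw [← mul_assoc]
  rcases x with i | i <;> rcases y with j | j <;>
    simp only [DihedralGroup.r_mul_r, DihedralGroup.r_mul_sr, DihedralGroup.sr_mul_r,
      DihedralGroup.sr_mul_sr, alcove_mul_dihedralFun_r, alcove_mul_dihedralFun_sr, alcove_inj,
      map_add, map_sub] <;>
    refine ⟨?_, ?_, by trivial⟩ <;> ring

/-- The isomorphism of the infinite dihedral group onto `U`, as a homomorphism to `W`. -/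
def dihedralHom : DihedralGroup 0 →* W := MonoidHom.mk' dihedralFun dihedralFun_mul

theorem dihedralHom_injective : Function.Injective dihedralHom := by
  intro x y h
  replace h : alcove 0 0 false * dihedralFun x = alcove 0 0 false * dihedralFun y :=
    congrArg (fun w => alcove 0 0 false * w) h
  rcases x with i | i <;> rcases y with j | j <;>
    simp only [alcove_mul_dihedralFun_r, alcove_mul_dihedralFun_sr, alcove_inj] at h
  · exact congrArg DihedralGroup.r (zmodZero.injective (add_left_cancel h.1))
  · exact absurd h.2.2 (by decide)
  · exact absurd h.2.2 (by decide)
  · exact congrArg DihedralGroup.sr (zmodZero.injective (add_left_cancel h.1))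

theorem U_eq_range_dihedralHom : U = dihedralHom.range := by
  apply le_antisymm
  · rw [U, Subgroup.closure_le]
    rintro x (rfl | rfl)
    · refine ⟨.sr (zmodZero.symm 1), ?_⟩
      apply mul_left_cancel (a := alcove 0 0 false)
      refine (alcove_mul_dihedralFun_sr 0 0 _ false).trans ?_
      rw [alcove_mul_v, AddEquiv.apply_symm_apply]
      rfl
    · refine ⟨.sr 0, ?_⟩
      change u * (u * v) ^ zmodZero 0 = u
      simp
  · have hu : u ∈ U := Subgroup.subset_closure (by simp)
    have hv : v ∈ U := Subgroup.subset_closure (by simp)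
    rintro _ ⟨i | i, rfl⟩
    · exact zpow_mem (mul_mem hu hv) _
    · exact mul_mem hu (zpow_mem (mul_mem hu hv) _)

theorem nonempty_U_mulEquiv_dihedralGroup : Nonempty (U ≃* DihedralGroup 0) :=
  ⟨(MulEquiv.subgroupCongr U_eq_range_dihedralHom).trans
    (MonoidHom.ofInjective dihedralHom_injective).symm⟩

/-- The left cosets of `U` are the fibres of `a - b`. -/
theorem alcove_mem_smul_U {a b a' b' : ℤ} {ε ε' : Bool} :
    alcove a' b' ε' ∈ alcove a b ε • (U : Set W) ↔ a' - b' = a - b := by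
  constructor
  · rintro ⟨z, hz, h⟩
    rw [U_eq_range_dihedralHom] at hz
    obtain ⟨i | i, rfl⟩ := hz
    · replace h := (alcove_mul_dihedralFun_r a b i ε).symm.trans h
      rw [alcove_inj] at h
      omega
    · replace h := (alcove_mul_dihedralFun_sr a b i ε).symm.trans h
      rw [alcove_inj] at h
      omega
  · intro h
    have hu : u ∈ U := Subgroup.subset_closure (by simp)
    have hv : v ∈ U := Subgroup.subset_closure (by simp)
    by_cases hε : ε' = ε
    · subst hε
      refine ⟨_, zpow_mem (mul_mem hu hv) (a' - a), ?_⟩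
      change alcove a b ε' * _ = _
      rw [alcove_mul_uv_zpow, alcove_inj]
      exact ⟨by omega, by omega, rfl⟩
    · refine ⟨_, mul_mem hu (zpow_mem (mul_mem hu hv) (a' + b + 1)), ?_⟩
      change alcove a b ε * _ = _
      rw [← mul_assoc, alcove_mul_u, alcove_mul_uv_zpow, alcove_inj]
      cases ε <;> cases ε' <;> simp_all <;> omega

theorem isUniqueMinimal_iff {x y : W} (hy : y ∈ x • (U : Set W)) :
    IsUniqueMinimal (x • (U : Set W)) y ↔ ∃ i : ℤ, y = (pre i)⁻¹ := by
  obtain ⟨a, b, ε, rfl⟩ := alcove_surjective x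
  have hs : strip (a - b) ∈ alcove a b ε • (U : Set W) := by
    rw [strip, alcove_mem_smul_U]
    omega
  have hlt : ∀ z ∈ alcove a b ε • (U : Set W), z ≠ strip (a - b) →
      length (strip (a - b)) < length z := by
    intro z hz hne
    obtain ⟨a', b', ε', rfl⟩ := alcove_surjective z
    rw [alcove_mem_smul_U] at hz
    have h0 : a' + b' + (bif ε' then 1 else 0) ≠ 0 := fun h => hne (eq_strip h hz)
    rw [length_strip, length_alcove]
    unfold hyperplaneCount
    cases ε' <;> simp only [cond_true, cond_false] at h0 ⊢ <;> omega
  constructor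
  · rintro ⟨-, h⟩
    refine ⟨a - b, ?_⟩
    rw [pre_inv]
    by_contra hne
    exact lt_asymm (h _ hs (Ne.symm hne)) (hlt y hy hne)
  · rintro ⟨i, rfl⟩
    rw [pre_inv] at hy ⊢
    obtain rfl : i = a - b := by
      rw [strip, alcove_mem_smul_U] at hy
      omega
    exact ⟨hs, hlt⟩

theorem exists_pre_mul (g : W) : ∃ i : ℤ, ∃ z ∈ U, g = (pre i)⁻¹ * z := by
  obtain ⟨a, b, ε, rfl⟩ := alcove_surjective g
  have : alcove a b ε ∈ strip (a - b) • (U : Set W) := by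
    rw [strip, alcove_mem_smul_U]
    omega
  obtain ⟨z, hz, h⟩ := this
  exact ⟨a - b, z, hz, by rw [pre_inv]; exact h.symm⟩

theorem lB_formulas (i k : ℤ) :
      (Even i → lB ((pre i)⁻¹ * u * (v * u) ^ k) = -4 * k - 3) ∧
      (Odd i → lB ((pre i)⁻¹ * u * (v * u) ^ k) = -4 * k - 2) ∧
      (Even i → lB ((pre i)⁻¹ * (v * u) ^ k) = -4 * k) ∧
      (Odd i → lB ((pre i)⁻¹ * (v * u) ^ k) = -4 * k - 1) ∧
      (Even i → lB ((pre i)⁻¹ * v * (u * v) ^ k) = 4 * k + 1) ∧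
      (Odd i → lB ((pre i)⁻¹ * v * (u * v) ^ k) = 4 * k + 2) ∧
      (Even i → lB ((pre i)⁻¹ * (u * v) ^ k) = 4 * k) ∧
      (Odd i → lB ((pre i)⁻¹ * (u * v) ^ k) = 4 * k - 1) := by
  rw [pre_inv, strip, alcove_mul_u, alcove_mul_v, alcove_mul_vu_zpow, alcove_mul_vu_zpow,
    alcove_mul_uv_zpow,
    alcove_mul_uv_zpow, lB_alcove, lB_alcove, lB_alcove, lB_alcove, Int.even_iff, Int.odd_iff]
  rcases Int.emod_two_eq_zero_or_one i with h | h
  · rw [decide_eq_false (by omega)]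
    simp only [Bool.not_false, cond_true, cond_false]
    omega
  · rw [decide_eq_true (by omega)]
    simp only [Bool.not_true, cond_true, cond_false]
    omega

theorem spherical_three_iff {x y : W} (h : IsIntervalOfLength x y 3) : IsSpherical x y ↔
    (x ∈ (sα * sβ * sα) • (T : Set W) ∧ y = sα * sβ * sα * x) ∨
    (x ∈ sβ • (T : Set W) ∧ y = s₀ * sβ * s₀ * x) ∨
    (x ∈ sα • (T : Set W) ∧ y = sα * s₀ * sα * x) := by
  obtain ⟨a, b, ε, rfl⟩ := alcove_surjective x
  rw [isSpherical_three_alcove h]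
  constructor
  · rintro ⟨rfl, rfl⟩
    have h3 : (a - b) % 3 = 0 ∨ (a - b) % 3 = 1 ∨ (a - b) % 3 = 2 := by omega
    rcases h3 with h3 | h3 | h3
    · left
      have hm := (alcove_mem_smul_T (g := .aba)).2 (finPart_eq_aba.2 ⟨rfl, h3⟩)
      obtain ⟨a', b', -, e, e'⟩ := mem_aba_smul_T.1 hm
      obtain ⟨rfl, rfl, -⟩ := alcove_inj.1 e
      exact ⟨hm, e'.symm⟩
    · right; left
      have hm := (alcove_mem_smul_T (g := .b)).2 (finPart_eq_b.2 ⟨rfl, h3⟩)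
      obtain ⟨a', b', -, e, e'⟩ := mem_b_smul_T.1 hm
      obtain ⟨rfl, rfl, -⟩ := alcove_inj.1 e
      exact ⟨hm, e'.symm⟩
    · right; right
      have hm := (alcove_mem_smul_T (g := .a)).2 (finPart_eq_a.2 ⟨rfl, h3⟩)
      obtain ⟨a', b', -, e, e'⟩ := mem_a_smul_T.1 hm
      obtain ⟨rfl, rfl, -⟩ := alcove_inj.1 e
      exact ⟨hm, e'.symm⟩
  · rintro (⟨hx, rfl⟩ | ⟨hx, rfl⟩ | ⟨hx, rfl⟩)
    · obtain ⟨a', b', -, e, e'⟩ := mem_aba_smul_T.1 hx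
      rw [e']
      obtain ⟨rfl, rfl, rfl⟩ := alcove_inj.1 e
      exact ⟨rfl, rfl⟩
    · obtain ⟨a', b', -, e, e'⟩ := mem_b_smul_T.1 hx
      rw [e']
      obtain ⟨rfl, rfl, rfl⟩ := alcove_inj.1 e
      exact ⟨rfl, rfl⟩
    · obtain ⟨a', b', -, e, e'⟩ := mem_a_smul_T.1 hx
      rw [e']
      obtain ⟨rfl, rfl, rfl⟩ := alcove_inj.1 e
      exact ⟨rfl, rfl⟩

end AlcoveModel

end

open AlcoveModel in
theorem mainTheorem9 :
    -- (1)(a) intervals of length 2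
    (∀ x y : W, IsIntervalOfLength x y 2 →
      ((∃ r₁ ∈ S, ∃ r₂ ∈ S, r₁ ≠ r₂ ∧ y = r₁ * r₂ * x) ∨
        (∃ γ ∈ ({α, β, α + β, δ - α, δ - β, δ - α - β} : Set V'),
          (y : V' ≃ₗ[ℝ] V') = s (δ - γ) * s γ * x)) ∧
      ((∃ r₁ ∈ S, ∃ r₂ ∈ S, r₁ ≠ r₂ ∧ y = r₁ * r₂ * x) → IsSpherical x y) ∧
      ((∃ γ ∈ ({α, β, α + β, δ - α, δ - β, δ - α - β} : Set V'),
          (y : V' ≃ₗ[ℝ] V') = s (δ - γ) * s γ * x) → ¬ IsSpherical x y)) ∧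
    -- (1)(b) intervals of length 3: the three families consist of intervals of length 3,
    -- and they are exactly the spherical ones
    (∀ x ∈ (sα * sβ * sα) • (T : Set W), IsIntervalOfLength x (sα * sβ * sα * x) 3) ∧
    (∀ x ∈ sβ • (T : Set W), IsIntervalOfLength x (s₀ * sβ * s₀ * x) 3) ∧
    (∀ x ∈ sα • (T : Set W), IsIntervalOfLength x (sα * s₀ * sα * x) 3) ∧
    (∀ x y : W, IsIntervalOfLength x y 3 →
      (IsSpherical x y ↔
        (x ∈ (sα * sβ * sα) • (T : Set W) ∧ y = sα * sβ * sα * x) ∨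
        (x ∈ sβ • (T : Set W) ∧ y = s₀ * sβ * s₀ * x) ∨
        (x ∈ sα • (T : Set W) ∧ y = sα * s₀ * sα * x))) ∧
    -- (1)(c) intervals of length greater than 3
    (∀ (x y : W) (n : ℕ), 3 < n → IsIntervalOfLength x y n → ¬ IsSpherical x y) ∧
    -- (2) the two infinite reduced words and their unique prefixes of each length
    IsInfiniteReducedWord xWord ∧
    IsInfiniteReducedWord yWord ∧
    (∀ (i : ℕ) (g : W), (IsPrefix g xWord ∧ length g = i) ↔ g = pre i) ∧
    (∀ (i : ℕ) (g : W), (IsPrefix g yWord ∧ length g = i) ↔ g = pre (-(i : ℤ))) ∧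
    -- (2) the infinite dihedral subgroup and its minimal left coset representatives
    Nonempty (U ≃* DihedralGroup 0) ∧
    (∀ x : W, ∀ y ∈ x • (U : Set W),
      (IsUniqueMinimal (x • (U : Set W)) y ↔ ∃ i : ℤ, y = (pre i)⁻¹)) ∧
    (∀ g : W, ∃ i : ℤ, ∃ z ∈ U, g = (pre i)⁻¹ * z) ∧
    -- (2)(a)-(d) the formula for the twisted length
    (∀ i k : ℤ,
      (Even i → lB ((pre i)⁻¹ * u * (v * u) ^ k) = -4 * k - 3) ∧
      (Odd i → lB ((pre i)⁻¹ * u * (v * u) ^ k) = -4 * k - 2) ∧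
      (Even i → lB ((pre i)⁻¹ * (v * u) ^ k) = -4 * k) ∧
      (Odd i → lB ((pre i)⁻¹ * (v * u) ^ k) = -4 * k - 1) ∧
      (Even i → lB ((pre i)⁻¹ * v * (u * v) ^ k) = 4 * k + 1) ∧
      (Odd i → lB ((pre i)⁻¹ * v * (u * v) ^ k) = 4 * k + 2) ∧
      (Even i → lB ((pre i)⁻¹ * (u * v) ^ k) = 4 * k) ∧
      (Odd i → lB ((pre i)⁻¹ * (u * v) ^ k) = 4 * k - 1)) ∧
    -- (3) poset automorphisms
    (∀ x y : W, lB x ≡ lB y [ZMOD 2] → ∃ γ : leB ≃r leB, γ x = y) := by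
  refine ⟨?_, ?_, ?_, ?_, fun x y h => spherical_three_iff h,
    fun x y n hn h => not_isSpherical_of_three_lt hn h, isInfiniteReducedWord_xWord,
    isInfiniteReducedWord_yWord, isPrefix_xWord_iff, isPrefix_yWord_iff,
    nonempty_U_mulEquiv_dihedralGroup, fun x y hy => isUniqueMinimal_iff hy, exists_pre_mul,
    lB_formulas, fun x y h => exists_automorphism h⟩
  · intro x y h
    obtain ⟨a, b, ε, rfl⟩ := alcove_surjective x
    rw [exists_simple_iff h, exists_reflections_iff h, isSpherical_two_alcove h]
    refine ⟨?_, id, ?_⟩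
    · have := isInterval_two_alcove.1 h
      tauto
    · rintro (rfl | rfl) <;> simp [alcove_inj]
  · intro x hx
    obtain ⟨a, b, -, rfl, e⟩ := mem_aba_smul_T.1 hx
    rw [e]
    exact isInterval_three_alcove a b
  · intro x hx
    obtain ⟨a, b, -, rfl, e⟩ := mem_b_smul_T.1 hx
    rw [e]
    exact isInterval_three_alcove a b
  · intro x hx
    obtain ⟨a, b, -, rfl, e⟩ := mem_a_smul_T.1 hx
    rw [e]
    exact isInterval_three_alcove a b
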